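/- Setting. Let $\rho$ be a quasi-metric on a non-empty set $\mathbb X$: $\rho\ge 0$, $\rho(x,y)=0$ iff $x=y$, $\rho(x,y)=\rho(y,x)$, and $\rho(x,y)\le\kappa_1(\rho(x,z)+\rho(z,y))$ with $\kappa_1\ge 1$. Give $\mathbb X$ the topology having the balls $\{y:\rho(x,y)<r\}$, $r>0$, as a basis, and write $\mathbb B(x,r)=\{y:\rho(x,y)\le r\}$. Let $\mu^*$ be a probability measure on $\mathbb X$, defined on a $\sigma$-algebra containing the Borel sets. Let $0=\lambda_0\le\lambda_1\le\cdots$ with $\lambda_k\to\infty$, and let $\phi_k:\mathbb X\to\mathbb R$ ($k\ge 0$) be continuous bounded functions, orthonormal with respect to $\mu^*$, with $\phi_0\equiv 1$. Assume that $(\mathbb X,\rho,\mu^*,\{\lambda_k\},\{\phi_k\})$ is a data-defined space, i.e., all balls $\mathbb B(x,r)$, $r>0$, are compact, and there are $q,\kappa_2,\kappa_3,\kappa_4>0$ such that $\mu^*(\mathbb B(x,r))\le\kappa_2r^q$ for all $x\in\mathbb X$, $r>0$, and such that for all $x,y\in\mathbb X$ and $0<t\le 1$ the series $K_t(x,y)=\sum_{k}e^{-\lambda_k^2t}\phi_k(x)\phi_k(y)$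 converges and $|K_t(x,y)|\le\kappa_3t^{-q/2}\exp(-\kappa_4\rho(x,y)^2/t)$. Functions are real or complex valued. Let $\Pi_n=\mathrm{span}\{\phi_j:\lambda_j<n\}$; its elements are called diffusion polynomials of degree less than $n$. Let $1\le p\le\infty$, $1/p'=1-1/p$, let $\|\cdot\|_p$ be the norm of $L^p(\mu^*)$, let $X^p$ be the $L^p(\mu^*)$-closure of the set of all diffusion polynomials, and put $\hat f(k)=\int f\phi_k\,d\mu^*$. For $r>0$, $W^p_r$ is the set of $f\in X^p$ for which there is $\Delta^rf\in X^p$ with $\widehat{\Delta^rf}(k)=(\lambda_k+1)^r\hat f(k)$ for all $k$, and $$\omega_r(p;f,\delta)=\inf\{\|f-f_1\|_p+\delta^r\|\Delta^rf_1\|_p: f_1\in W^p_r\}.$$ For $\gamma>0$ fix $r>\gamma$; $H^p_\gamma$ is the set of $f\in X^p$ with $\|f\|_{H^p_\gamma}=\|f\|_p+\sup_{0<\delta\le 1}\delta^{-\gamma}\omega_r(p;f,\delta)<\infty$. For a measure $\nu$ on $\mathbb X$ (signed or positive) with total variation measure $|\nu|$ and for $d>0$, $\nu$ is $d$-regular if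 there is $C\ge 0$ with $|\nu|(\mathbb B(x,d))\le Cd^q$ for all $x\in\mathbb X$; the infimum of such $C$ is denoted $|\!|\!|\nu|\!|\!|_{R,d}$. Theorem. Let $1\le p\le\infty$, $\gamma>q/p$ and $r>\gamma$. There is a constant $c>0$, depending only on $\mathbb X,\rho,\mu^*,q,\kappa_1,\dots,\kappa_4,p,\gamma,r$ (but not on $\{\lambda_k\}$ and $\{\phi_k\}$ otherwise), with the following property. Let $n\ge 1$ be real, $A\ge 0$, and let $\nu$ be a $1/n$-regular measure with $|\nu|(\mathbb X)<\infty$ such that $$\left|\int P\,d\mu^*-\int P\,d\nu\right|\le A\,\frac{\|P\|_{H^p_\gamma}}{n^\gamma}\qquad\text{for all }P\in\Pi_n.$$ Then every $f\in H^p_\gamma$ is $\mu^*$-almost everywhere equal to a unique continuous function, this function is $|\nu|$-integrable, and, with $\int f\,d\nu$ denoting the integral of this continuous representative, $$\left|\int f\,d\mu^*-\int f\,d\nu\right|\le c\left(A+|\!|\!|\nu|\!|\!|_{R,1/n}^{1/p}\,|\nu|(\mathbb X)^{1/p'}\right)\frac{\|f\|_{H^p_\gamma}}{n^\gamma},$$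 where $t^0=1$ for all $t\ge 0$. -/

import Mathlib

open MeasureTheory Filter Topology
open scoped ENNReal

noncomputable section

namespace DataSpace

/-- `ρ` is a quasi-metric on `X` with constant `κ₁` in the relaxed triangle inequality. -/
structure IsQuasiMetric {X : Type*} (ρ : X → X → ℝ) (κ₁ : ℝ) : Prop where
  nonneg : ∀ x y, 0 ≤ ρ x y
  eq_zero_iff : ∀ x y, ρ x y = 0 ↔ x = y
  symm : ∀ x y, ρ x y = ρ y x
  one_le_const : 1 ≤ κ₁
  triangle : ∀ x y z, ρ x y ≤ κ₁ * (ρ x z + ρ z y)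

/-- The closed ball `𝔹(x, r) = {y : ρ(x, y) ≤ r}`. -/
def cball {X : Type*} (ρ : X → X → ℝ) (x : X) (r : ℝ) : Set X := {y | ρ x y ≤ r}

/-- The formal heat kernel `K_t(x, y) = ∑ₖ exp(-λₖ² t) φₖ(x) φₖ(y)`. -/
def heatKernel {X : Type*} (lam : ℕ → ℝ) (φ : ℕ → X → ℝ) (t : ℝ) (x y : X) : ℝ :=
  ∑' k, Real.exp (-(lam k) ^ 2 * t) * φ k x * φ k y

/-- `(X, ρ, μ, (λₖ), (φₖ))` is a data-defined space with exponent `q` and constants `κ₁, …, κ₄`.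
The topology of `X` is the one having the open balls of `ρ` as a basis. -/
structure IsDataDefinedSpace {X : Type*} [TopologicalSpace X] [MeasurableSpace X]
    (ρ : X → X → ℝ) (μ : Measure X) (lam : ℕ → ℝ) (φ : ℕ → X → ℝ)
    (q κ₁ κ₂ κ₃ κ₄ : ℝ) : Prop where
  quasiMetric : IsQuasiMetric ρ κ₁
  basis : TopologicalSpace.IsTopologicalBasis
    {U : Set X | ∃ (x : X) (r : ℝ), 0 < r ∧ U = {y | ρ x y < r}}
  -- the "eigenvalues" and the orthonormal "eigenfunctions"
  lam_zero : lam 0 = 0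
  lam_mono : Monotone lam
  lam_tendsto : Tendsto lam atTop atTop
  φ_zero : ∀ x, φ 0 x = 1
  φ_continuous : ∀ k, Continuous (φ k)
  φ_bounded : ∀ k, ∃ M : ℝ, ∀ x, |φ k x| ≤ M
  φ_orthonormal : ∀ j k, ∫ x, φ k x * φ j x ∂μ = if j = k then 1 else 0
  -- geometry
  isCompact_ball : ∀ (x : X) (r : ℝ), 0 < r → IsCompact (cball ρ x r)
  q_pos : 0 < q
  κ₂_pos : 0 < κ₂
  measure_ball_le : ∀ (x : X) (r : ℝ), 0 < r → μ (cball ρ x r) ≤ ENNReal.ofReal (κ₂ * r ^ q)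
  -- heat kernel; on the diagonal the terms are nonnegative, so by Cauchy-Schwarz convergence of
  -- the partial sums at all pairs of points is the same as (absolute) summability at all pairs
  summable_heat : ∀ (t : ℝ), 0 < t → t ≤ 1 → ∀ x y : X,
    Summable fun k => Real.exp (-(lam k) ^ 2 * t) * φ k x * φ k y
  κ₃_pos : 0 < κ₃
  κ₄_pos : 0 < κ₄
  gaussian_bound : ∀ (t : ℝ), 0 < t → t ≤ 1 → ∀ x y : X,
    |heatKernel lam φ t x y| ≤ κ₃ * t ^ (-q / 2) * Real.exp (-κ₄ * (ρ x y ^ 2 / t))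

section Functions

variable {X : Type*} {𝕜 : Type*} [RCLike 𝕜]

/-- All diffusion polynomials: finite `𝕜`-linear combinations of the `φₖ`. -/
def diffPoly (𝕜 : Type*) [RCLike 𝕜] (φ : ℕ → X → ℝ) : Submodule 𝕜 (X → 𝕜) :=
  Submodule.span 𝕜 {F | ∃ j, F = fun x => ((φ j x : ℝ) : 𝕜)}

/-- `Π_n`, the span of the `φⱼ` with `λⱼ < n`. -/
def diffPolyDeg (𝕜 : Type*) [RCLike 𝕜] (lam : ℕ → ℝ) (φ : ℕ → X → ℝ) (n : ℝ) :
    Submodule 𝕜 (X → 𝕜) :=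
  Submodule.span 𝕜 {F | ∃ j, lam j < n ∧ F = fun x => ((φ j x : ℝ) : 𝕜)}

variable [MeasurableSpace X]

/-- `f ∈ X^p`: `f` belongs to the `L^p(μ)`-closure of the diffusion polynomials. -/
def MemXp (μ : Measure X) (φ : ℕ → X → ℝ) (p : ℝ≥0∞) (f : X → 𝕜) : Prop :=
  MemLp f p μ ∧ ∀ ε : ℝ≥0∞, 0 < ε → ∃ P ∈ diffPoly 𝕜 φ, eLpNorm (f - P) p μ < ε

/-- The Fourier coefficient `f̂(k) = ∫ f φₖ dμ`. -/
def coeff (μ : Measure X) (φ : ℕ → X → ℝ) (f : X → 𝕜) (k : ℕ) : 𝕜 :=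
  ∫ x, f x * ((φ k x : ℝ) : 𝕜) ∂μ

/-- `f ∈ W^p_r` with `Δ^r f = g`: both functions are in `X^p` and
`ĝ(k) = (λₖ + 1)^r f̂(k)` for all `k`. -/
def IsPseudoDeriv (μ : Measure X) (lam : ℕ → ℝ) (φ : ℕ → X → ℝ) (p : ℝ≥0∞) (r : ℝ)
    (f g : X → 𝕜) : Prop :=
  MemXp μ φ p f ∧ MemXp μ φ p g ∧
    ∀ k, coeff μ φ g k = (((lam k + 1) ^ r : ℝ) : 𝕜) * coeff μ φ f k

/-- The `K`-functional `ω_r(p; f, δ) = inf {‖f - f₁‖_p + δ^r ‖Δ^r f₁‖_p : f₁ ∈ W^p_r}`. -/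
def kFunctional (μ : Measure X) (lam : ℕ → ℝ) (φ : ℕ → X → ℝ) (p : ℝ≥0∞) (r : ℝ)
    (f : X → 𝕜) (δ : ℝ) : ℝ≥0∞ :=
  ⨅ (f₁ : X → 𝕜) (g : X → 𝕜) (_ : IsPseudoDeriv μ lam φ p r f₁ g),
    eLpNorm (f - f₁) p μ + ENNReal.ofReal (δ ^ r) * eLpNorm g p μ

/-- The norm `‖f‖_{H^p_γ} = ‖f‖_p + sup_{0 < δ ≤ 1} ω_r(p; f, δ) / δ^γ`, possibly infinite. -/
def hNorm (μ : Measure X) (lam : ℕ → ℝ) (φ : ℕ → X → ℝ) (p : ℝ≥0∞) (γ r : ℝ)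
    (f : X → 𝕜) : ℝ≥0∞ :=
  eLpNorm f p μ +
    ⨆ δ ∈ Set.Ioc (0 : ℝ) 1, kFunctional μ lam φ p r f δ / ENNReal.ofReal (δ ^ γ)

/-- `f ∈ H^p_γ`. -/
def MemH (μ : Measure X) (lam : ℕ → ℝ) (φ : ℕ → X → ℝ) (p : ℝ≥0∞) (γ r : ℝ)
    (f : X → 𝕜) : Prop :=
  MemXp μ φ p f ∧ hNorm μ lam φ p γ r f < ∞

end Functions

section Measures

variable {X : Type*} [MeasurableSpace X]

/-- The constants `C ≥ 0` for which `|ν|(𝔹(x, d)) ≤ C d^q` for all `x`. -/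
def regConstants (ρ : X → X → ℝ) (q : ℝ) (ν : SignedMeasure X) (d : ℝ) : Set ℝ :=
  {C | 0 ≤ C ∧ ∀ x, ν.variation (cball ρ x d) ≤ ENNReal.ofReal (C * d ^ q)}

/-- `ν` is `d`-regular. -/
def IsRegular (ρ : X → X → ℝ) (q : ℝ) (ν : SignedMeasure X) (d : ℝ) : Prop :=
  (regConstants ρ q ν d).Nonempty

/-- `|||ν|||_{R,d}`, the infimum of the admissible constants. -/
def regNorm (ρ : X → X → ℝ) (q : ℝ) (ν : SignedMeasure X) (d : ℝ) : ℝ :=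
  sInf (regConstants ρ q ν d)

/-- The integral `∫ f dν` of a scalar function against a signed measure. -/
def sintegral {𝕜 : Type*} [RCLike 𝕜] (ν : SignedMeasure X) (f : X → 𝕜) : 𝕜 :=
  ν.integral f (ContinuousLinearMap.lsmul ℝ ℝ).flip

/-- `|∫ P dμ - ∫ P dν| ≤ A ‖P‖_{H^p_γ} n^{-γ}` for all `P ∈ Π_n`. -/
def ApproxQuadrature (𝕜 : Type*) [RCLike 𝕜] (μ : Measure X) (lam : ℕ → ℝ) (φ : ℕ → X → ℝ)
    (p : ℝ≥0∞) (γ r n A : ℝ) (ν : SignedMeasure X) : Prop :=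
  ∀ P ∈ diffPolyDeg 𝕜 lam φ n,
    ‖(∫ x, P x ∂μ) - sintegral ν P‖ ≤ A * (hNorm μ lam φ p γ r P).toReal / n ^ γ

end Measures

end DataSpace

end

noncomputable section

namespace DataSpace

/-! ### Rapidly convergent cosine expansions of smooth functions. -/

section CosineExpansion

open scoped Real ContDiff

/-! Let P be the smooth spectral truncation `lowPass` of f to degree below n. It has the same mean
as f, so the error is the quadrature error of P plus the ν-integral of P minus the continuous
representative of f. Truncation is bounded on L^p and commutes with Δ^r, so ‖P‖_H ≤ C‖f‖_H and the
hypothesis on ν handles the first term.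

The second term is telescoped into the differences of the truncations at 2^(i+1) n and 2^i n. The
K-functional bounds their L^p(μ) norms by C (2^i n)^(-γ) ‖f‖_H (`exists_step_bound`). Each
difference is its own truncation at a comparable higher frequency; integrating that kernel against
|ν| costs a factor 2^(iq/p) and produces |||ν|||^(1/p) |ν|(X)^(1/p') (`exists_step_lintegral_bound`,
by the Hölder argument of `IsDataDefinedSpace.lintegral_multOp_le`). As γ > q/p, the sum over i is a
convergent geometric series. With a Dirac mass in place of |ν|, the same estimate shows that the
telescoping series converges uniformly, which yields the continuous representative.

All of this rests on localization: a smooth multiplier at frequency N has kernel O(N^q (1 +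
Nρ)^(-S)) for any S (`exists_multKernel_bound`). It is derived from the heat kernel alone. Put u =
exp(-(λ/N)²), so that powers of u are heat operators. The Chebyshev polynomial T_m(u), times u,
combines heat kernels at times at most (m+1)/N²; its coefficients grow at most like 3^m, and the
Gaussian beats this beyond distance of order m/N (`exists_weighted_cosKernel_bound`). Smooth
functions of u have rapidly decaying Chebyshev coefficients (`exists_cos_expansion`), so summation
over m keeps polynomial decay of any prescribed order.

Conservation of heat together with the Gaussian bound gives a lower volume bound
(`IsDataDefinedSpace.exists_volume_lower`). Hence X is bounded and compact, μ charges every nonempty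
open set (so continuous representatives are unique), and control of |ν| on balls of radius 1/n
passes to larger balls by covering. -/

theorem contDiff_partial_snd {G : ℝ × ℝ → ℂ} (hG : ContDiff ℝ ∞ G) :
    ContDiff ℝ ∞ fun z => fderiv ℝ G z (0, 1) :=
  (hG.fderiv_right (m := ∞) (by simp)).clm_apply contDiff_const

theorem hasDerivAt_partial_snd {G : ℝ × ℝ → ℂ} (hG : ContDiff ℝ ∞ G) (η θ : ℝ) :
    HasDerivAt (fun θ => G (η, θ)) (fderiv ℝ G (η, θ) (0, 1)) θ := by
  have h1 : HasFDerivAt G (fderiv ℝ G (η, θ)) (η, θ) :=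
    (hG.differentiable (by simp) _).hasFDerivAt
  have h2 : HasDerivAt (fun θ : ℝ => (η, θ)) ((0 : ℝ), (1 : ℝ)) θ :=
    (hasDerivAt_const θ η).prodMk (hasDerivAt_id θ)
  exact h1.comp_hasDerivAt θ h2

theorem fderiv_periodic {G : ℝ × ℝ → ℂ}
    (hp : ∀ η θ, G (η, θ + 2 * π) = G (η, θ)) (η θ : ℝ) :
    fderiv ℝ G (η, θ + 2 * π) = fderiv ℝ G (η, θ) := by
  have h : (fun z : ℝ × ℝ => G (z + (0, 2 * π))) = G := by
    funext z
    obtain ⟨a, b⟩ := z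
    simpa using hp a b
  have h2 := fderiv_comp_add_right (𝕜 := ℝ) (f := G) (x := (η, θ)) ((0 : ℝ), 2 * π)
  rw [h] at h2
  simpa using h2.symm

/-- The unnormalized Fourier coefficient of `G(η, ·)` over a period. -/
def circleCoeff (G : ℝ × ℝ → ℂ) (η : ℝ) (n : ℤ) : ℂ :=
  ∫ θ in (0 : ℝ)..(2 * π), Complex.exp (-(n * θ * Complex.I)) * G (η, θ)

theorem norm_exp_int_mul_I (n : ℤ) (θ : ℝ) : ‖Complex.exp (-(n * θ * Complex.I))‖ = 1 := by
  have : (-(n * θ * Complex.I) : ℂ) = ((-(n * θ) : ℝ) : ℂ) * Complex.I := by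
    push_cast; ring
  rw [this, Complex.norm_exp_ofReal_mul_I]

/-- Integration by parts; the boundary terms cancel because the exponential and G both have period
2π. -/
theorem circleCoeff_partial {G : ℝ × ℝ → ℂ} (hG : ContDiff ℝ ∞ G)
    (hp : ∀ η θ, G (η, θ + 2 * π) = G (η, θ)) (η : ℝ) (n : ℤ) :
    circleCoeff (fun z => fderiv ℝ G z (0, 1)) η n = n * Complex.I * circleCoeff G η n := by
  unfold circleCoeff
  have hu : ∀ θ : ℝ, HasDerivAt (fun θ : ℝ => Complex.exp (-(n * θ * Complex.I)))
      (Complex.exp (-(n * θ * Complex.I)) * (-(n * Complex.I))) θ := by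
    intro θ
    have h1 : HasDerivAt (fun θ : ℝ => (-(n * θ * Complex.I) : ℂ)) (-(n * Complex.I)) θ := by
      have h0 : HasDerivAt (fun θ : ℝ => (θ : ℂ)) 1 θ := Complex.ofRealCLM.hasDerivAt
      simpa using ((h0.const_mul (n : ℂ)).mul_const Complex.I).fun_neg
    exact h1.cexp
  have hcE : Continuous fun θ : ℝ => Complex.exp (-(n * θ * Complex.I)) := by fun_prop
  have hc2 : Continuous fun θ : ℝ => fderiv ℝ G (η, θ) (0, 1) :=
    (contDiff_partial_snd hG).continuous.comp (by fun_prop)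
  have key := intervalIntegral.integral_mul_deriv_eq_deriv_mul (a := 0) (b := 2 * π)
    (u := fun θ : ℝ => Complex.exp (-(n * θ * Complex.I))) (v := fun θ => G (η, θ))
    (u' := fun θ => Complex.exp (-(n * θ * Complex.I)) * (-(n * Complex.I)))
    (v' := fun θ => fderiv ℝ G (η, θ) (0, 1))
    (fun θ _ => hu θ) (fun θ _ => hasDerivAt_partial_snd hG η θ)
    ((hcE.mul continuous_const).intervalIntegrable _ _)
    (hc2.intervalIntegrable _ _)
  rw [key]
  have hper : G (η, 2 * π) = G (η, 0) := by simpa using hp η 0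
  have hE : Complex.exp (-(n * ((2 * π : ℝ) : ℂ) * Complex.I)) = 1 := by
    have := Complex.exp_int_mul_two_pi_mul_I (-n)
    rw [← this]; congr 1; push_cast; ring
  rw [hE, hper]
  simp only [Complex.ofReal_zero, mul_zero, zero_mul, neg_zero, Complex.exp_zero, sub_self,
    zero_sub]
  rw [← intervalIntegral.integral_neg, ← intervalIntegral.integral_const_mul]
  congr 1
  funext θ
  ring

/-- Induction over all G at once: one more power of n is obtained by applying the previous case to
the θ-derivative. Uniformity in η comes from compactness of the parameter rectangle in the base
case. -/
theorem exists_circleCoeff_bound (S : ℕ) : ∀ {G : ℝ × ℝ → ℂ}, ContDiff ℝ ∞ G →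
    (∀ η θ, G (η, θ + 2 * π) = G (η, θ)) →
    ∃ C : ℝ, 0 ≤ C ∧ ∀ η ∈ Set.Icc (0 : ℝ) 1, ∀ n : ℤ, |(n : ℝ)| ^ S * ‖circleCoeff G η n‖ ≤ C := by
  induction S with
  | zero =>
    intro G hG _
    obtain ⟨M, hM⟩ := ((isCompact_Icc (a := (0 : ℝ)) (b := 1)).prod
      (isCompact_Icc (a := (0 : ℝ)) (b := 2 * π))).exists_bound_of_continuousOn
      hG.continuous.continuousOn
    have hpi := Real.pi_pos
    have hM0 : 0 ≤ M := (norm_nonneg _).trans (hM (0, 0) ⟨by simp, by simp; positivity⟩)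
    refine ⟨M * (2 * π), by positivity, fun η hη n => ?_⟩
    rw [pow_zero, one_mul]
    have := intervalIntegral.norm_integral_le_of_norm_le_const (a := 0) (b := 2 * π) (C := M)
      (f := fun θ : ℝ => Complex.exp (-(n * θ * Complex.I)) * G (η, θ)) (fun θ hθ => ?_)
    · simpa [abs_of_pos (show (0 : ℝ) < 2 * π by positivity), circleCoeff, abs_of_pos hpi] using this
    · rw [Set.uIoc_of_le (by positivity)] at hθ
      rw [norm_mul, norm_exp_int_mul_I, one_mul]
      exact hM (η, θ) ⟨hη, hθ.1.le, hθ.2⟩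
  | succ S ih =>
    intro G hG hp
    obtain ⟨C, hC, h⟩ := ih (contDiff_partial_snd hG)
      (fun η θ => by rw [fderiv_periodic hp])
    refine ⟨C, hC, fun η hη n => ?_⟩
    have := h η hη n
    rw [circleCoeff_partial hG hp] at this
    simpa [pow_succ, mul_assoc] using this

/-- Uniform rapidly converging Fourier expansion of a smooth family of periodic functions. -/
theorem hasSum_circleCoeff {G : ℝ × ℝ → ℂ} (hG : ContDiff ℝ ∞ G)
    (hp : ∀ η θ, G (η, θ + 2 * π) = G (η, θ)) {η : ℝ}
    (hs : Summable fun n => circleCoeff G η n) (θ : ℝ) :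
    HasSum (fun n : ℤ => (1 / (2 * π) : ℂ) * circleCoeff G η n * Complex.exp (n * θ * Complex.I))
      (G (η, θ)) := by
  have : Fact (0 < 2 * π) := ⟨by positivity⟩
  have hper : Function.Periodic (fun θ => G (η, θ)) (2 * π) := fun θ => hp η θ
  have hcont : Continuous (hper.lift) := by
    apply continuous_coinduced_dom.mpr
    have : Continuous fun θ => G (η, θ) := hG.continuous.comp (by fun_prop)
    exact this
  have hco : ∀ n : ℤ, fourierCoeff (⟨hper.lift, hcont⟩ : C(AddCircle (2 * π), ℂ)) n
      = (1 / (2 * π) : ℂ) * circleCoeff G η n := by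
    intro n
    rw [fourierCoeff_eq_intervalIntegral _ _ 0, zero_add]
    unfold circleCoeff
    rw [Complex.real_smul]
    congr 1
    · push_cast; rfl
    · refine intervalIntegral.integral_congr fun θ _ => ?_
      simp only [ContinuousMap.coe_mk, Function.Periodic.lift_coe, smul_eq_mul]
      congr 1
      rw [fourier_coe_apply]
      congr 1
      have : (π : ℂ) ≠ 0 := by exact_mod_cast Real.pi_ne_zero
      push_cast
      field_simp
  have hsum : Summable (fourierCoeff (⟨hper.lift, hcont⟩ : C(AddCircle (2 * π), ℂ))) := by
    have : (fourierCoeff (⟨hper.lift, hcont⟩ : C(AddCircle (2 * π), ℂ)))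
      = fun n => (1 / (2 * π) : ℂ) * circleCoeff G η n := funext hco
    rw [this]
    exact hs.mul_left _
  have := has_pointwise_sum_fourier_series_of_summable hsum (θ : AddCircle (2 * π))
  simp only [ContinuousMap.coe_mk, Function.Periodic.lift_coe] at this
  refine this.congr_fun ?_
  intro n
  have hn : fourierCoeff hper.lift n = (1 / (2 * π) : ℂ) * circleCoeff G η n := hco n
  rw [smul_eq_mul, hn]
  congr 1
  rw [fourier_coe_apply]
  congr 1
  have : (π : ℂ) ≠ 0 := by exact_mod_cast Real.pi_ne_zero
  push_cast
  field_simp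

theorem summable_int_inv_sq : Summable fun n : ℤ => (1 / (1 + |(n : ℝ)|) ^ 2 : ℝ) := by
  have h : Summable fun n : ℤ => 1 / |(n : ℝ)| ^ 2 := by
    simpa using (Real.summable_one_div_int_pow (p := 2)).2 (by norm_num)
  refine Summable.of_norm_bounded_eventually (g := fun n : ℤ => 1 / |(n : ℝ)| ^ 2) h ?_
  have : ({0}ᶜ : Set ℤ) ∈ (cofinite : Filter ℤ) := (Set.finite_singleton 0).compl_mem_cofinite
  filter_upwards [this] with n hn
  have hn0 : (0 : ℝ) < |(n : ℝ)| := by simpa using hn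
  rw [Real.norm_of_nonneg (by positivity)]
  gcongr
  linarith

/-- A smooth family `Γ(η, ·)`, `0 ≤ η ≤ 1`, has cosine expansions in `arccos u` whose coefficients
decay faster than a given power, uniformly in `η`. -/
theorem exists_cos_expansion {Γ : ℝ × ℝ → ℝ} (hΓ : ContDiff ℝ ∞ Γ) (S : ℕ) :
    ∃ C : ℝ, 0 ≤ C ∧ ∀ η ∈ Set.Icc (0 : ℝ) 1, ∃ a : ℤ → ℝ,
      Summable (fun n => |a n| * (1 + |(n : ℝ)|) ^ S) ∧
      ∑' n, |a n| * (1 + |(n : ℝ)|) ^ S ≤ C ∧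
      ∀ u ∈ Set.Icc (-1 : ℝ) 1, HasSum (fun n : ℤ => a n * Real.cos (n * Real.arccos u)) (Γ (η, u)) := by
  -- The substitution u = cos θ turns a function on an interval into an even periodic one, so no
  -- endpoint conditions arise.
  set G : ℝ × ℝ → ℂ := fun z => ((Γ (z.1, Real.cos z.2) : ℝ) : ℂ) with hGdef
  have hG : ContDiff ℝ ∞ G := by
    have : ContDiff ℝ ∞ fun z : ℝ × ℝ => Γ (z.1, Real.cos z.2) :=
      hΓ.comp (contDiff_fst.prodMk (Real.contDiff_cos.comp contDiff_snd))
    exact Complex.ofRealCLM.contDiff.comp this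
  have hp : ∀ η θ, G (η, θ + 2 * π) = G (η, θ) := by
    intro η θ; simp [hGdef]
  obtain ⟨C₀, hC₀, h₀⟩ := exists_circleCoeff_bound 0 hG hp
  -- Beyond the weight of order S, two further powers make the sum over n converge; the bound `C₀`
  -- of order zero covers small n.
  obtain ⟨C₁, hC₁, h₁⟩ := exists_circleCoeff_bound (S + 2) hG hp
  set C : ℝ := 2 ^ (S + 2) * (C₀ + C₁)
  have hC : 0 ≤ C := by positivity
  have hdec : ∀ η ∈ Set.Icc (0 : ℝ) 1, ∀ n : ℤ,
      ‖circleCoeff G η n‖ * (1 + |(n : ℝ)|) ^ S ≤ C * (1 / (1 + |(n : ℝ)|) ^ 2) := by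
    intro η hη n
    have hpos : (0 : ℝ) < 1 + |(n : ℝ)| := by positivity
    rw [mul_one_div, le_div_iff₀ (by positivity), mul_assoc, ← pow_add]
    have h0 := h₀ η hη n
    have h1 := h₁ η hη n
    rw [pow_zero, one_mul] at h0
    have : (1 + |(n : ℝ)|) ^ (S + 2) ≤ 2 ^ (S + 2) * (1 + |(n : ℝ)| ^ (S + 2)) := by
      rcases le_total |(n : ℝ)| 1 with h | h
      · calc (1 + |(n : ℝ)|) ^ (S + 2) ≤ 2 ^ (S + 2) := by gcongr; linarith
          _ ≤ _ := le_mul_of_one_le_right (by positivity)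
              (by linarith [pow_nonneg (abs_nonneg (n : ℝ)) (S + 2)])
      · calc (1 + |(n : ℝ)|) ^ (S + 2) ≤ (2 * |(n : ℝ)|) ^ (S + 2) := by gcongr; linarith
          _ = 2 ^ (S + 2) * |(n : ℝ)| ^ (S + 2) := by rw [mul_pow]
          _ ≤ _ := by gcongr; linarith
    calc ‖circleCoeff G η n‖ * (1 + |(n : ℝ)|) ^ (S + 2)
        ≤ ‖circleCoeff G η n‖ * (2 ^ (S + 2) * (1 + |(n : ℝ)| ^ (S + 2))) := by gcongr
      _ = 2 ^ (S + 2) * (‖circleCoeff G η n‖ + |(n : ℝ)| ^ (S + 2) * ‖circleCoeff G η n‖) := by ring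
      _ ≤ C := mul_le_mul_of_nonneg_left (add_le_add h0 h1) (by positivity)
  refine ⟨C * ∑' n : ℤ, (1 / (1 + |(n : ℝ)|) ^ 2 : ℝ),
    mul_nonneg hC (tsum_nonneg fun n => by positivity), fun η hη => ?_⟩
  have hpi : (1 / (2 * π)) ≤ 1 := by
    rw [div_le_one (by positivity)]
    linarith [Real.pi_gt_three]
  have habs : ∀ n : ℤ, |(1 / (2 * π)) * (circleCoeff G η n).re| ≤ ‖circleCoeff G η n‖ := by
    intro n
    rw [abs_mul, abs_of_pos (by positivity)]
    calc 1 / (2 * π) * |(circleCoeff G η n).re| ≤ 1 * ‖circleCoeff G η n‖ := by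
          gcongr
          exact Complex.abs_re_le_norm _
      _ = _ := one_mul _
  have hle : ∀ n : ℤ, |(1 / (2 * π)) * (circleCoeff G η n).re| * (1 + |(n : ℝ)|) ^ S
      ≤ C * (1 / (1 + |(n : ℝ)|) ^ 2) := fun n =>
    (mul_le_mul_of_nonneg_right (habs n) (by positivity)).trans (hdec η hη n)
  have hsg : Summable fun n : ℤ => C * (1 / (1 + |(n : ℝ)|) ^ 2) := summable_int_inv_sq.mul_left C
  have hs1 := Summable.of_nonneg_of_le (fun n => by positivity) hle hsg
  refine ⟨fun n => (1 / (2 * π)) * (circleCoeff G η n).re, hs1, ?_, fun u hu => ?_⟩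
  · rw [← tsum_mul_left]
    exact hs1.tsum_le_tsum hle hsg
  · have hsc : Summable fun n => circleCoeff G η n := by
      refine Summable.of_norm_bounded hsg fun n => le_trans ?_ (hdec η hη n)
      refine le_mul_of_one_le_right (norm_nonneg _) (one_le_pow₀ ?_)
      linarith [abs_nonneg (n : ℝ)]
    set θ := Real.arccos u
    have hθ : Real.cos θ = u := Real.cos_arccos hu.1 hu.2
    -- Averaging the expansions at θ and -θ replaces exponentials by cosines; taking real parts
    -- makes the coefficients real.
    have e1 := hasSum_circleCoeff hG hp hsc θ
    have e2 := hasSum_circleCoeff hG hp hsc (-θ)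
    have e3 := Complex.hasSum_re ((e1.add e2).mul_left (1 / 2))
    convert e3 using 1
    · funext n
      have : (1 / 2 : ℂ) * ((1 / (2 * π) : ℂ) * circleCoeff G η n * Complex.exp (n * θ * Complex.I)
          + (1 / (2 * π) : ℂ) * circleCoeff G η n * Complex.exp (n * ((-θ : ℝ) : ℂ) * Complex.I))
          = ((1 / (2 * π) * Real.cos (n * θ) : ℝ) : ℂ) * circleCoeff G η n := by
        have hc : ((Real.cos (n * θ) : ℝ) : ℂ) = (Complex.exp (n * θ * Complex.I)
          + Complex.exp (n * ((-θ : ℝ) : ℂ) * Complex.I)) / 2 := by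
          rw [Complex.ofReal_cos, Complex.cos]
          push_cast
          ring_nf
        rw [Complex.ofReal_mul, hc]
        push_cast
        ring
      rw [this, Complex.re_ofReal_mul]
      ring
    · simp [hGdef, hθ]
      ring

end CosineExpansion

/-! ### Localization of spectral multipliers from Gaussian heat kernel bounds. -/

section HeatKernel

open scoped Real ContDiff

/-- The values `exp(-(λₖ / N)²)` of the heat multiplier at time `N⁻²`. -/
def heatNode (lam : ℕ → ℝ) (N : ℝ) (k : ℕ) : ℝ := Real.exp (-(lam k / N) ^ 2)

theorem heatNode_pos (lam : ℕ → ℝ) (N : ℝ) (k : ℕ) : 0 < heatNode lam N k := Real.exp_pos _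

theorem heatNode_le_one (lam : ℕ → ℝ) (N : ℝ) (k : ℕ) : heatNode lam N k ≤ 1 := by
  rw [heatNode, Real.exp_le_one_iff]
  nlinarith [sq_nonneg (lam k / N)]

theorem heatNode_pow (lam : ℕ → ℝ) (N : ℝ) (k j : ℕ) :
    heatNode lam N k ^ j = Real.exp (-(lam k) ^ 2 * (j / N ^ 2)) := by
  rw [heatNode, ← Real.exp_nat_mul]
  congr 1
  ring

variable {X : Type*} [TopologicalSpace X] [MeasurableSpace X]
  {ρ : X → X → ℝ} {μ : Measure X} {lam : ℕ → ℝ} {φ : ℕ → X → ℝ} {q κ₁ κ₂ κ₃ κ₄ : ℝ}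

theorem IsDataDefinedSpace.summable_node (h : IsDataDefinedSpace ρ μ lam φ q κ₁ κ₂ κ₃ κ₄)
    {N : ℝ} (hN : 1 ≤ N) (x y : X) :
    Summable fun k => heatNode lam N k * φ k x * φ k y := by
  have := h.summable_heat (1 / N ^ 2) (by positivity)
    (by rw [div_le_one (by positivity)]; exact one_le_pow₀ hN) x y
  refine this.congr fun k => ?_
  rw [← pow_one (heatNode lam N k), heatNode_pow, Nat.cast_one]

/-- The j-th power of the node is the heat flow at time j/N². Over 1 ≤ j ≤ L the prefactor is worst
at the shortest time and the Gaussian at the longest; L ≤ N² keeps all times at most 1. -/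
theorem IsDataDefinedSpace.abs_tsum_node_pow_le
    (h : IsDataDefinedSpace ρ μ lam φ q κ₁ κ₂ κ₃ κ₄)
    {N : ℝ} (hN : 1 ≤ N) (x y : X) {j L : ℕ} (hj : 1 ≤ j) (hjL : j ≤ L) (hL : (L : ℝ) ≤ N ^ 2) :
    |∑' k, heatNode lam N k ^ j * φ k x * φ k y|
      ≤ κ₃ * N ^ q * Real.exp (-κ₄ * ((N * ρ x y) ^ 2 / L)) := by
  have hN0 : 0 < N := by linarith
  have hj' : (1 : ℝ) ≤ j := by exact_mod_cast hj
  have hjL' : (j : ℝ) ≤ L := by exact_mod_cast hjL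
  have h1 := h.gaussian_bound (j / N ^ 2) (by positivity)
    (by rw [div_le_one (by positivity)]; linarith) x y
  simp only [heatKernel, ← heatNode_pow] at h1
  refine h1.trans ?_
  have hκ₃ := h.κ₃_pos
  have hκ₄ := h.κ₄_pos
  have hq := h.q_pos
  have e1 : ((j : ℝ) / N ^ 2) ^ (-q / 2) ≤ N ^ q := by
    calc ((j : ℝ) / N ^ 2) ^ (-q / 2) ≤ (1 / N ^ 2) ^ (-q / 2) := by
          apply Real.rpow_le_rpow_of_nonpos (by positivity) _ (by linarith)
          gcongr
      _ = N ^ q := by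
          rw [one_div, ← Real.rpow_natCast, ← Real.rpow_neg hN0.le, ← Real.rpow_mul hN0.le]
          congr 1
          push_cast; ring
  have e2 : (N * ρ x y) ^ 2 / (L : ℝ) ≤ ρ x y ^ 2 / (j / N ^ 2) := by
    rw [div_div_eq_mul_div, mul_comm (ρ x y ^ 2), ← mul_pow]
    gcongr
  gcongr κ₃ * ?_ * Real.exp ?_
  nlinarith

/-- The heat multiplier at time `N⁻²` composed with a cosine of `arccos`, as a kernel. -/
def cosKernel (lam : ℕ → ℝ) (φ : ℕ → X → ℝ) (N : ℝ) (m i : ℕ) (x y : X) : ℝ :=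
  ∑' k, Real.cos (m * Real.arccos (heatNode lam N k)) * (heatNode lam N k ^ i * φ k x * φ k y)

theorem IsDataDefinedSpace.summable_cosKernel (h : IsDataDefinedSpace ρ μ lam φ q κ₁ κ₂ κ₃ κ₄)
    {N : ℝ} (hN : 1 ≤ N) (m : ℕ) {i : ℕ} (hi : 1 ≤ i) (x y : X) :
    Summable fun k => Real.cos (m * Real.arccos (heatNode lam N k)) *
      (heatNode lam N k ^ i * φ k x * φ k y) := by
  refine Summable.of_norm_bounded (h.summable_node hN x y).norm fun k => ?_
  have h0 := (heatNode_pos lam N k).le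
  rw [norm_mul]
  calc _ ≤ 1 * ‖heatNode lam N k ^ i * φ k x * φ k y‖ := by
        gcongr; exact Real.abs_cos_le_one _
    _ ≤ _ := by
        rw [one_mul, mul_assoc, mul_assoc, norm_mul, norm_mul (heatNode lam N k),
          Real.norm_of_nonneg h0, Real.norm_of_nonneg (pow_nonneg h0 i)]
        gcongr
        exact pow_le_of_le_one h0 (heatNode_le_one lam N k) (by omega)

/-- The recurrence T_(m+2) = 2u T_(m+1) - T_m: multiplying by u raises i by one while the Chebyshev
degree drops by one, so i + m never exceeds L. The factor 3^m absorbs the coefficients, since 2·3 +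
1 ≤ 9. Requiring i ≥ 1 keeps every heat time positive. -/
theorem IsDataDefinedSpace.abs_cosKernel_le_pow (h : IsDataDefinedSpace ρ μ lam φ q κ₁ κ₂ κ₃ κ₄)
    {N : ℝ} (hN : 1 ≤ N) (x y : X) {L : ℕ} {B : ℝ}
    (hB : ∀ j, 1 ≤ j → j ≤ L → |∑' k, heatNode lam N k ^ j * φ k x * φ k y| ≤ B) (m : ℕ) :
    ∀ i, 1 ≤ i → i + m ≤ L → |cosKernel lam φ N m i x y| ≤ 3 ^ m * B := by
  induction m using Nat.strong_induction_on with
  | _ m ih =>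
    intro i hi hiL
    have hB0 : 0 ≤ B := (abs_nonneg _).trans (hB i hi (by omega))
    have hcos : ∀ k, Real.cos (Real.arccos (heatNode lam N k)) = heatNode lam N k := fun k =>
      Real.cos_arccos (by linarith [heatNode_pos lam N k]) (heatNode_le_one lam N k)
    match m, ih, hiL with
    | 0, _, hiL => simpa [cosKernel] using hB i hi (by omega)
    | 1, _, hiL =>
      have : cosKernel lam φ N 1 i x y = ∑' k, heatNode lam N k ^ (i + 1) * φ k x * φ k y := by
        refine tsum_congr fun k => ?_
        rw [Nat.cast_one, one_mul, hcos]; ring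
      rw [this]
      linarith [hB (i + 1) (by omega) hiL]
    | m + 2, ih, hiL =>
      have e : cosKernel lam φ N (m + 2) i x y
          = 2 * cosKernel lam φ N (m + 1) (i + 1) x y - cosKernel lam φ N m i x y := by
        unfold cosKernel
        rw [← tsum_mul_left, ← Summable.tsum_sub
          ((h.summable_cosKernel hN (m + 1) (by omega) x y).mul_left 2)
          (h.summable_cosKernel hN m hi x y)]
        refine tsum_congr fun k => ?_
        set θ := Real.arccos (heatNode lam N k)
        have hc := Real.cos_add_cos ((m + 2 : ℕ) * θ) (m * θ)
        have a1 : (((m + 2 : ℕ) : ℝ) * θ + m * θ) / 2 = ((m + 1 : ℕ) : ℝ) * θ := by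
          push_cast; ring
        have a2 : (((m + 2 : ℕ) : ℝ) * θ - m * θ) / 2 = θ := by push_cast; ring
        rw [a1, a2, hcos] at hc
        rw [eq_sub_of_add_eq hc]
        ring
      have i1 := ih (m + 1) (by omega) (i + 1) (by omega) (by omega)
      have i2 := ih m (by omega) i hi (by omega)
      rw [e]
      calc _ ≤ 2 * |cosKernel lam φ N (m + 1) (i + 1) x y| + |cosKernel lam φ N m i x y| := by
            refine (abs_sub _ _).trans ?_
            rw [abs_mul, abs_two]
        _ ≤ 2 * (3 ^ (m + 1) * B) + 3 ^ m * B := by gcongr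
        _ ≤ 3 ^ (m + 2) * B := by
            have : 0 ≤ 3 ^ m * B := by positivity
            rw [pow_succ 3 (m + 1), pow_succ 3 m]; linarith

/-- The inequality 2|ab| ≤ a² + b² reduces to the diagonal, where the terms are nonnegative and the
series is the heat kernel itself. -/
theorem IsDataDefinedSpace.tsum_abs_node_le (h : IsDataDefinedSpace ρ μ lam φ q κ₁ κ₂ κ₃ κ₄)
    {N : ℝ} (hN : 1 ≤ N) (x y : X) :
    ∑' k, |heatNode lam N k * φ k x * φ k y| ≤ κ₃ * N ^ q := by
  have hd : ∀ z, ∑' k, heatNode lam N k * φ k z * φ k z ≤ κ₃ * N ^ q := by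
    intro z
    have := h.abs_tsum_node_pow_le hN z z le_rfl le_rfl (by rw [Nat.cast_one]; exact one_le_pow₀ hN)
    rw [(h.quasiMetric.eq_zero_iff z z).2 rfl] at this
    simp only [pow_one] at this
    refine (le_abs_self _).trans (this.trans ?_)
    simp
  have hx := h.summable_node hN x x
  have hy := h.summable_node hN y y
  have hle : ∀ k, |heatNode lam N k * φ k x * φ k y| ≤
      (1 / 2) * (heatNode lam N k * φ k x * φ k x + heatNode lam N k * φ k y * φ k y) := by
    intro k
    have h0 := (heatNode_pos lam N k).le
    rw [mul_assoc, abs_mul, abs_of_nonneg h0]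
    have : |φ k x * φ k y| ≤ (1 / 2) * (φ k x * φ k x + φ k y * φ k y) := by
      rw [abs_le]
      constructor <;> nlinarith [sq_nonneg (φ k x + φ k y), sq_nonneg (φ k x - φ k y)]
    calc _ ≤ heatNode lam N k * ((1 / 2) * (φ k x * φ k x + φ k y * φ k y)) := by gcongr
      _ = _ := by ring
  have hs := (hx.add hy).mul_left (1 / 2)
  refine ((h.summable_node hN x y).abs.tsum_le_tsum hle hs).trans ?_
  rw [tsum_mul_left, hx.tsum_add hy]
  linarith [hd x, hd y]

theorem IsDataDefinedSpace.abs_cosKernel_le (h : IsDataDefinedSpace ρ μ lam φ q κ₁ κ₂ κ₃ κ₄)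
    {N : ℝ} (hN : 1 ≤ N) (m : ℕ) (x y : X) : |cosKernel lam φ N m 1 x y| ≤ κ₃ * N ^ q := by
  have hs := h.summable_cosKernel hN m le_rfl x y
  refine le_trans ?_ (h.tsum_abs_node_le hN x y)
  have h1 := norm_tsum_le_tsum_norm hs.norm
  refine le_trans h1 (hs.norm.tsum_le_tsum (fun k => ?_) (h.summable_node hN x y).abs)
  rw [norm_mul, pow_one]
  exact mul_le_of_le_one_left (norm_nonneg _) (Real.abs_cos_le_one _)

theorem one_add_pow_mul_exp_neg_le {a : ℝ} (ha : 0 ≤ a) (S : ℕ) :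
    (1 + a) ^ S * Real.exp (-a) ≤ S.factorial * Real.exp 1 := by
  have h1 := Real.pow_div_factorial_le_exp (1 + a) (by linarith) S
  rw [div_le_iff₀ (by positivity), Real.exp_add] at h1
  calc _ ≤ Real.exp 1 * Real.exp a * S.factorial * Real.exp (-a) := by gcongr
    _ = S.factorial * Real.exp 1 * (Real.exp a * Real.exp (-a)) := by ring
    _ = _ := by rw [← Real.exp_add]; simp

/-- Polynomials of degree `m` in the heat operator are essentially supported at distance `m / N`
from the diagonal. -/
theorem exists_weighted_cosKernel_bound (ρ : X → X → ℝ) (μ : Measure X) (q κ₁ κ₂ : ℝ) {κ₃ κ₄ D : ℝ}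
    (hκ₃ : 0 < κ₃) (hκ₄ : 0 < κ₄) (hD : ∀ x y, ρ x y ≤ D) (S : ℕ) :
    ∃ C : ℝ, 0 ≤ C ∧ ∀ (lam : ℕ → ℝ) (φ : ℕ → X → ℝ),
      IsDataDefinedSpace ρ μ lam φ q κ₁ κ₂ κ₃ κ₄ → ∀ (N : ℝ), 1 ≤ N → ∀ (m : ℕ) (x y : X),
        |cosKernel lam φ N m 1 x y| * (1 + N * ρ x y) ^ S ≤ C * (1 + m) ^ S * N ^ q := by
  -- The three lower bounds on `c` serve the far regime: D forces m + 1 < N, 2 gives 3^m ≤ e^a, and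
  -- 2/κ₄ makes the Gaussian at most e^(-2a).
  set c : ℝ := max D (max 2 (2 / κ₄)) with hc
  have hcD : D ≤ c := le_max_left _ _
  have hc2 : 2 ≤ c := (le_max_left _ _).trans (le_max_right _ _)
  have hcκ : 2 ≤ κ₄ * c := by
    have : 2 / κ₄ ≤ c := (le_max_right _ _).trans (le_max_right _ _)
    rw [div_le_iff₀ hκ₄] at this
    linarith
  refine ⟨κ₃ * ((1 + c) ^ S + S.factorial * Real.exp 1), by positivity, ?_⟩
  intro lam φ h N hN m x y
  have hN0 : 0 < N := by linarith
  set a := N * ρ x y with ha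
  have ha0 : 0 ≤ a := mul_nonneg hN0.le (h.quasiMetric.nonneg x y)
  have hNq : 0 < N ^ q := Real.rpow_pos_of_pos hN0 q
  have hm1 : (1 : ℝ) ≤ (1 + m) ^ S := one_le_pow₀ (by linarith [(Nat.cast_nonneg m : (0 : ℝ) ≤ m)])
  have hf : 0 ≤ S.factorial * Real.exp 1 := by positivity
  -- Near the diagonal the weight is at most a multiple of (1 + m)^S and the trivial kernel bound
  -- suffices; far away the Gaussian takes over.
  rcases le_or_gt a (c * (m + 1)) with hle | hgt
  · calc |cosKernel lam φ N m 1 x y| * (1 + a) ^ S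
        ≤ (κ₃ * N ^ q) * ((1 + c) * (1 + m)) ^ S := by
          gcongr
          · exact h.abs_cosKernel_le hN m x y
          · nlinarith [(Nat.cast_nonneg m : (0 : ℝ) ≤ m)]
      _ = κ₃ * ((1 + c) ^ S + 0) * (1 + m) ^ S * N ^ q := by rw [mul_pow]; ring
      _ ≤ _ := by gcongr
  -- The diameter bound enters here: heat times up to (m+1)/N² stay in (0, 1], the only range where
  -- the Gaussian bound is assumed.
  · have hmN : (m : ℝ) + 1 < N := by
      have h1 : a ≤ N * c := by
        rw [ha]; gcongr; exact (hD x y).trans hcD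
      have : c * (m + 1) < c * N := by linarith
      exact lt_of_mul_lt_mul_left this (by linarith)
    have hL : ((m + 1 : ℕ) : ℝ) ≤ N ^ 2 := by push_cast; nlinarith
    have hb := h.abs_cosKernel_le_pow hN x y
      (fun j h1 h2 => h.abs_tsum_node_pow_le hN x y h1 h2 hL) m 1 le_rfl (by omega)
    have hm0 : (0 : ℝ) < (m + 1 : ℕ) := by positivity
    have h3 : (3 : ℝ) ^ m ≤ Real.exp a := by
      have : (3 : ℝ) ≤ Real.exp 2 := by linarith [Real.add_one_le_exp (2 : ℝ)]
      calc (3 : ℝ) ^ m ≤ Real.exp 2 ^ m := by gcongr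
        _ = Real.exp (m * 2) := by rw [← Real.exp_nat_mul]
        _ ≤ Real.exp a := by
          gcongr
          nlinarith [(Nat.cast_nonneg m : (0 : ℝ) ≤ m)]
    have h4 : Real.exp (-κ₄ * (a ^ 2 / (m + 1 : ℕ))) ≤ Real.exp (-(2 * a)) := by
      gcongr
      have : c * a ≤ a ^ 2 / (m + 1 : ℕ) := by
        rw [le_div_iff₀ hm0]; push_cast; nlinarith
      nlinarith
    have h5 : |cosKernel lam φ N m 1 x y| ≤ κ₃ * N ^ q * Real.exp (-a) := by
      calc _ ≤ _ := hb
        _ ≤ Real.exp a * (κ₃ * N ^ q * Real.exp (-(2 * a))) := by gcongr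
        _ = κ₃ * N ^ q * (Real.exp a * Real.exp (-(2 * a))) := by ring
        _ = _ := by rw [← Real.exp_add]; ring_nf
    calc |cosKernel lam φ N m 1 x y| * (1 + a) ^ S
        ≤ κ₃ * N ^ q * Real.exp (-a) * (1 + a) ^ S := by gcongr
      _ = κ₃ * N ^ q * ((1 + a) ^ S * Real.exp (-a)) := by ring
      _ ≤ κ₃ * N ^ q * (S.factorial * Real.exp 1) := by
          gcongr κ₃ * N ^ q * ?_
          exact one_add_pow_mul_exp_neg_le ha0 S
      _ = κ₃ * (0 + S.factorial * Real.exp 1) * 1 * N ^ q := by ring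
      _ ≤ _ := by gcongr; positivity

/-- The kernel of a finite spectral multiplier. -/
def multKernel (φ : ℕ → X → ℝ) (s : Finset ℕ) (m : ℕ → ℝ) (x y : X) : ℝ :=
  ∑ k ∈ s, m k * φ k x * φ k y

/-- Localization of the kernels of smooth compactly supported functions of the heat operator. -/
theorem exists_multKernel_bound (ρ : X → X → ℝ) (μ : Measure X) (q κ₁ κ₂ : ℝ) {κ₃ κ₄ D : ℝ}
    (hκ₃ : 0 < κ₃) (hκ₄ : 0 < κ₄) (hD : ∀ x y, ρ x y ≤ D) {Γ : ℝ × ℝ → ℝ} (hΓ : ContDiff ℝ ∞ Γ)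
    (S : ℕ) :
    ∃ C : ℝ, 0 ≤ C ∧ ∀ (lam : ℕ → ℝ) (φ : ℕ → X → ℝ),
      IsDataDefinedSpace ρ μ lam φ q κ₁ κ₂ κ₃ κ₄ → ∀ (N : ℝ), 1 ≤ N →
      ∀ η ∈ Set.Icc (0 : ℝ) 1, ∀ s : Finset ℕ, (∀ k ∉ s, Γ (η, heatNode lam N k) = 0) → ∀ x y : X,
        |multKernel φ s (fun k => Γ (η, heatNode lam N k) * heatNode lam N k) x y| *
          (1 + N * ρ x y) ^ S ≤ C * N ^ q := by
  obtain ⟨C₁, hC₁, h₁⟩ := exists_weighted_cosKernel_bound ρ μ q κ₁ κ₂ hκ₃ hκ₄ hD S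
  obtain ⟨C₂, hC₂, h₂⟩ := exists_cos_expansion hΓ S
  refine ⟨C₁ * C₂, by positivity, fun lam φ h N hN η hη s hs x y => ?_⟩
  obtain ⟨a, has, hat, ha⟩ := h₂ η hη
  have hN0 : 0 < N := by linarith
  have hW : 0 ≤ (1 + N * ρ x y) ^ S :=
    pow_nonneg (by nlinarith [mul_nonneg hN0.le (h.quasiMetric.nonneg x y)]) S
  have hNq : 0 < N ^ q := Real.rpow_pos_of_pos hN0 q
  have hSa : Summable fun n => |a n| := by
    refine Summable.of_nonneg_of_le (fun n => abs_nonneg _) (fun n => ?_) has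
    exact le_mul_of_one_le_right (abs_nonneg _) (one_le_pow₀ (by linarith [abs_nonneg (n : ℝ)]))
  set g : ℕ → ℝ := fun k => heatNode lam N k * φ k x * φ k y with hg
  have hgs : Summable g := h.summable_node hN x y
  set F : ℕ → ℤ → ℝ := fun k n => a n * Real.cos (n * Real.arccos (heatNode lam N k)) * g k with hF
  -- The spare factor of the heat node inside `g` makes the double series absolutely summable, which
  -- permits exchanging the sums over eigenvalues and over cosines.
  have hFs : Summable (Function.uncurry F) := by
    have hp := (hgs.norm).mul_of_nonneg (g := fun n => |a n|) hSa (fun k => norm_nonneg _)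
      (fun n => abs_nonneg _)
    refine Summable.of_norm_bounded hp fun z => ?_
    simp only [Function.uncurry, hF, norm_mul]
    rw [mul_comm]
    gcongr
    exact mul_le_of_le_one_right (abs_nonneg _) (Real.abs_cos_le_one _)
  have e1 : multKernel φ s (fun k => Γ (η, heatNode lam N k) * heatNode lam N k) x y
      = ∑' k, ∑' n, F k n := by
    have hk : ∀ k, ∑' n, F k n = Γ (η, heatNode lam N k) * g k := fun k =>
      ((ha _ ⟨by linarith [heatNode_pos lam N k], heatNode_le_one lam N k⟩).mul_right (g k)).tsum_eq
    simp_rw [hk]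
    rw [tsum_eq_sum (s := s) (fun k hk => by rw [hs k hk, zero_mul])]
    refine Finset.sum_congr rfl fun k _ => ?_
    simp only [hg]; ring
  have e2 : ∑' k, ∑' n, F k n = ∑' n : ℤ, a n * cosKernel lam φ N n.natAbs 1 x y := by
    rw [← Summable.tsum_comm hFs]
    refine tsum_congr fun n => ?_
    unfold cosKernel
    rw [← tsum_mul_left]
    refine tsum_congr fun k => ?_
    have : Real.cos ((n.natAbs : ℝ) * Real.arccos (heatNode lam N k))
        = Real.cos (n * Real.arccos (heatNode lam N k)) := by
      rw [Nat.cast_natAbs, Int.cast_abs]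
      rcases abs_choice (n : ℝ) with h | h <;> rw [h]
      rw [neg_mul, Real.cos_neg]
    simp only [hF, hg, this, pow_one]; ring
  have hb : ∀ n : ℤ, |a n * cosKernel lam φ N n.natAbs 1 x y| * (1 + N * ρ x y) ^ S
      ≤ (C₁ * N ^ q) * (|a n| * (1 + |(n : ℝ)|) ^ S) := by
    intro n
    have := h₁ lam φ h N hN n.natAbs x y
    rw [Nat.cast_natAbs, Int.cast_abs] at this
    rw [abs_mul, mul_assoc]
    calc _ ≤ |a n| * (C₁ * (1 + |(n : ℝ)|) ^ S * N ^ q) := by gcongr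
      _ = _ := by ring
  have hbs : Summable fun n : ℤ => |a n * cosKernel lam φ N n.natAbs 1 x y| := by
    refine Summable.of_nonneg_of_le (fun n => abs_nonneg _) (fun n => ?_)
      (hSa.mul_right (κ₃ * N ^ q))
    rw [abs_mul]
    gcongr
    exact h.abs_cosKernel_le hN _ x y
  rw [e1, e2]
  calc _ ≤ (∑' n : ℤ, |a n * cosKernel lam φ N n.natAbs 1 x y|) * (1 + N * ρ x y) ^ S := by
        have h0 := norm_tsum_le_tsum_norm hbs.of_abs.norm
        simp only [Real.norm_eq_abs] at h0
        exact mul_le_mul_of_nonneg_right h0 hW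
    _ = ∑' n : ℤ, |a n * cosKernel lam φ N n.natAbs 1 x y| * (1 + N * ρ x y) ^ S := by
        rw [tsum_mul_right]
    _ ≤ ∑' n : ℤ, (C₁ * N ^ q) * (|a n| * (1 + |(n : ℝ)|) ^ S) :=
        (hbs.mul_right ((1 + N * ρ x y) ^ S)).tsum_le_tsum hb (has.mul_left (C₁ * N ^ q))
    _ = (C₁ * N ^ q) * ∑' n : ℤ, (|a n| * (1 + |(n : ℝ)|) ^ S) := by rw [tsum_mul_left]
    _ ≤ (C₁ * N ^ q) * C₂ := mul_le_mul_of_nonneg_left hat (by positivity)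
    _ = _ := by ring

end HeatKernel

/-! ### Integrals of localized kernels, and conservation of heat. -/

section Geometry

variable {X : Type*} {ρ : X → X → ℝ} {κ₁ : ℝ}

theorem half_pow_mul_rpow_le {q : ℝ} {S : ℕ} (hS : q + 1 ≤ S) (j : ℕ) :
    ((1 / 2 : ℝ) ^ j) ^ S * ((2 : ℝ) ^ j) ^ q ≤ (1 / 2) ^ j := by
  have h1 : (1 : ℝ) ≤ 2 ^ j := one_le_pow₀ (by norm_num)
  have h2 : ((2 : ℝ) ^ j) ^ q ≤ ((2 : ℝ) ^ j) ^ ((S : ℝ) - 1) :=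
    Real.rpow_le_rpow_of_exponent_le h1 (by linarith)
  have h3 : ((2 : ℝ) ^ j) ^ ((S : ℝ) - 1) = ((2 : ℝ) ^ j) ^ S / 2 ^ j := by
    rw [Real.rpow_sub (by positivity), Real.rpow_natCast, Real.rpow_one]
  calc _ ≤ ((1 / 2 : ℝ) ^ j) ^ S * (((2 : ℝ) ^ j) ^ S / 2 ^ j) := by
        rw [← h3]; gcongr
    _ = (1 / 2) ^ j := by
        rw [mul_div_assoc', ← mul_pow, ← mul_pow]
        simp

/-- A kernel concentrated at distance `1 / N` is integrable against measures with controlled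
growth. -/
theorem lintegral_le_of_localized [MeasurableSpace X]
    (hmeas : ∀ x r, 0 < r → MeasurableSet (cball ρ x r)) {q : ℝ} {S : ℕ} (hS : q + 1 ≤ S)
    (m : Measure X) (M : ℝ≥0∞) {N B : ℝ} (hN : 0 < N) (hρ : ∀ x y, 0 ≤ ρ x y) (x : X)
    (K : X → ℝ) (hK : ∀ y, |K y| * (1 + N * ρ x y) ^ S ≤ B)
    (hm : ∀ j : ℕ, m (cball ρ x (2 ^ j / N)) ≤ M * ENNReal.ofReal (((2 : ℝ) ^ j) ^ q)) :
    ∫⁻ y, ‖K y‖ₑ ∂m ≤ ENNReal.ofReal (2 ^ (S + 1) * B) * M := by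
  have hB0 : 0 ≤ B := (mul_nonneg (abs_nonneg _)
    (pow_nonneg (by nlinarith [mul_nonneg hN.le (hρ x x)]) S)).trans (hK x)
  set c : ℕ → ℝ := fun j => 2 ^ S * B * ((1 / 2 : ℝ) ^ j) ^ S with hc
  have hc0 : ∀ j, 0 ≤ c j := fun j => by positivity
  have hpt : ∀ y, ‖K y‖ₑ ≤
      ∑' j, (cball ρ x (2 ^ j / N)).indicator (fun _ => ENNReal.ofReal (c j)) y := by
    intro y
    have ha : 0 ≤ N * ρ x y := mul_nonneg hN.le (hρ x y)
    have hex : ∃ j : ℕ, N * ρ x y ≤ 2 ^ j := by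
      obtain ⟨j, hj⟩ := pow_unbounded_of_one_lt (N * ρ x y) (one_lt_two (α := ℝ))
      exact ⟨j, hj.le⟩
    classical
    -- The minimal j places y in a dyadic shell: for j ≥ 1 the weight (1 + Nρ)^S is at least
    -- 2^((j-1)S), which beats the growth 2^(jq) of the measure because S ≥ q + 1.
    obtain ⟨j, hj, hmin⟩ : ∃ j : ℕ, N * ρ x y ≤ 2 ^ j ∧ ∀ i < j, ¬ N * ρ x y ≤ 2 ^ i :=
      ⟨Nat.find hex, Nat.find_spec hex, fun i hi => Nat.find_min hex hi⟩
    have hmem : y ∈ cball ρ x (2 ^ j / N) := by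
      simp only [cball, Set.mem_ofPred_eq]
      rw [le_div_iff₀ hN]; linarith
    refine le_trans ?_ (ENNReal.le_tsum j)
    rw [Set.indicator_of_mem hmem, Real.enorm_eq_ofReal_abs]
    apply ENNReal.ofReal_le_ofReal
    have hKy := hK y
    rcases j with _ | i
    · have h1 : (1 : ℝ) ≤ (1 + N * ρ x y) ^ S := one_le_pow₀ (by linarith)
      have h2 : (1 : ℝ) ≤ 2 ^ S := one_le_pow₀ (by norm_num)
      simp only [hc, pow_zero, one_pow, mul_one]
      nlinarith [abs_nonneg (K y)]
    · have hi := not_le.1 (hmin i (Nat.lt_succ_self i))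
      have h1 : ((2 : ℝ) ^ i) ^ S ≤ (1 + N * ρ x y) ^ S := by gcongr; linarith
      have h2 : |K y| * ((2 : ℝ) ^ i) ^ S ≤ B := le_trans (by gcongr) hKy
      have h3 : c (i + 1) = B * ((1 / 2 : ℝ) ^ i) ^ S := by
        simp only [hc, pow_succ, mul_pow]
        have : (2 : ℝ) ^ S * (1 / 2) ^ S = 1 := by rw [← mul_pow]; norm_num
        linear_combination (B * ((1 / 2 : ℝ) ^ i) ^ S) * this
      have h4 : ((2 : ℝ) ^ i) ^ S * ((1 / 2 : ℝ) ^ i) ^ S = 1 := by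
        rw [← mul_pow, ← mul_pow]; norm_num
      rw [h3]
      calc |K y| = |K y| * ((2 : ℝ) ^ i) ^ S * ((1 / 2 : ℝ) ^ i) ^ S := by
            rw [mul_assoc, h4, mul_one]
        _ ≤ _ := by gcongr
  have hpos : ∀ j : ℕ, (0 : ℝ) < 2 ^ j / N := fun j => by positivity
  calc ∫⁻ y, ‖K y‖ₑ ∂m
      ≤ ∫⁻ y, ∑' j, (cball ρ x (2 ^ j / N)).indicator (fun _ => ENNReal.ofReal (c j)) y ∂m :=
        lintegral_mono hpt
    _ = ∑' j, ENNReal.ofReal (c j) * m (cball ρ x (2 ^ j / N)) := by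
        rw [lintegral_tsum fun j =>
          (measurable_const.indicator (hmeas x _ (hpos j))).aemeasurable]
        refine tsum_congr fun j => ?_
        rw [lintegral_indicator_const (hmeas x _ (hpos j))]
    _ ≤ ∑' j : ℕ, ENNReal.ofReal (2 ^ S * B * (1 / 2) ^ j) * M := by
        refine ENNReal.tsum_le_tsum fun j => ?_
        calc _ ≤ ENNReal.ofReal (c j) * (M * ENNReal.ofReal (((2 : ℝ) ^ j) ^ q)) := by
              gcongr; exact hm j
          _ = ENNReal.ofReal (c j * ((2 : ℝ) ^ j) ^ q) * M := by
              rw [ENNReal.ofReal_mul (hc0 j)]; ring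
          _ ≤ _ := by
              gcongr ENNReal.ofReal ?_ * M
              simp only [hc]
              rw [mul_assoc]
              exact mul_le_mul_of_nonneg_left (half_pow_mul_rpow_le hS j) (by positivity)
    _ = ENNReal.ofReal (2 ^ (S + 1) * B) * M := by
        rw [ENNReal.tsum_mul_right, ← ENNReal.ofReal_tsum_of_nonneg (fun j => by positivity)
          (summable_geometric_two.mul_left _), tsum_mul_left, tsum_geometric_two]
        congr 2
        ring

theorem IsQuasiMetric.t2Space [TopologicalSpace X] (hq : IsQuasiMetric ρ κ₁)
    (hb : TopologicalSpace.IsTopologicalBasis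
      {U : Set X | ∃ (x : X) (r : ℝ), 0 < r ∧ U = {y | ρ x y < r}}) : T2Space X := by
  refine ⟨fun x y hxy => ?_⟩
  have hκ : 0 < κ₁ := by linarith [hq.one_le_const]
  have hpos : 0 < ρ x y := lt_of_le_of_ne (hq.nonneg x y)
    (fun h => hxy ((hq.eq_zero_iff x y).1 h.symm))
  have hr : 0 < ρ x y / (2 * κ₁) := by positivity
  refine ⟨{z | ρ x z < ρ x y / (2 * κ₁)}, {z | ρ y z < ρ x y / (2 * κ₁)},
    hb.isOpen ⟨x, _, hr, rfl⟩, hb.isOpen ⟨y, _, hr, rfl⟩, ?_, ?_, ?_⟩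
  · simpa [(hq.eq_zero_iff x x).2 rfl] using hr
  · simpa [(hq.eq_zero_iff y y).2 rfl] using hr
  · rw [Set.disjoint_left]
    intro z hz1 hz2
    simp only [Set.mem_ofPred_eq] at hz1 hz2
    have := hq.triangle x y z
    rw [hq.symm z y] at this
    have h2 : κ₁ * (ρ x z + ρ y z) < κ₁ * (2 * (ρ x y / (2 * κ₁))) := by
      gcongr; linarith
    have h3 : κ₁ * (2 * (ρ x y / (2 * κ₁))) = ρ x y := by field_simp
    linarith

variable [TopologicalSpace X] [MeasurableSpace X] {μ : Measure X}
  {lam : ℕ → ℝ} {φ : ℕ → X → ℝ} {q κ₂ κ₃ κ₄ : ℝ}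

theorem IsDataDefinedSpace.isClosed_cball (h : IsDataDefinedSpace ρ μ lam φ q κ₁ κ₂ κ₃ κ₄)
    (x : X) {r : ℝ} (hr : 0 < r) : IsClosed (cball ρ x r) :=
  have := h.quasiMetric.t2Space h.basis
  (h.isCompact_ball x r hr).isClosed

variable [OpensMeasurableSpace X]

theorem IsDataDefinedSpace.measurableSet_cball (h : IsDataDefinedSpace ρ μ lam φ q κ₁ κ₂ κ₃ κ₄)
    (x : X) (r : ℝ) (hr : 0 < r) : MeasurableSet (cball ρ x r) :=
  (h.isClosed_cball x hr).measurableSet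

variable [IsProbabilityMeasure μ]

theorem IsDataDefinedSpace.integrable_mul (h : IsDataDefinedSpace ρ μ lam φ q κ₁ κ₂ κ₃ κ₄)
    (j k : ℕ) : Integrable (fun x => φ j x * φ k x) μ := by
  obtain ⟨M, hM⟩ := h.φ_bounded j
  obtain ⟨M', hM'⟩ := h.φ_bounded k
  refine Integrable.of_bound (C := M * M')
    ((h.φ_continuous j).mul (h.φ_continuous k)).aestronglyMeasurable (ae_of_all _ fun x => ?_)
  rw [norm_mul]
  have := (abs_nonneg _).trans (hM x)
  exact mul_le_mul (hM x) (hM' x) (norm_nonneg _) this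

theorem IsDataDefinedSpace.integrable (h : IsDataDefinedSpace ρ μ lam φ q κ₁ κ₂ κ₃ κ₄)
    (k : ℕ) : Integrable (φ k) μ := by
  simpa [h.φ_zero] using h.integrable_mul k 0

/-- Trace of the heat operator: integrating the bounded diagonal of the kernel over a probability
space bounds every partial sum. -/
theorem IsDataDefinedSpace.summable_heatNode (h : IsDataDefinedSpace ρ μ lam φ q κ₁ κ₂ κ₃ κ₄)
    {N : ℝ} (hN : 1 ≤ N) : Summable (heatNode lam N) := by
  refine summable_of_sum_le (c := κ₃ * N ^ q) (fun k => (heatNode_pos lam N k).le) fun s => ?_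
  have e : ∑ k ∈ s, heatNode lam N k = ∫ x, ∑ k ∈ s, heatNode lam N k * (φ k x * φ k x) ∂μ := by
    rw [integral_finsetSum _ fun k _ => (h.integrable_mul k k).const_mul _]
    refine Finset.sum_congr rfl fun k _ => ?_
    rw [integral_const_mul, h.φ_orthonormal k k, if_pos rfl, mul_one]
  rw [e]
  have hle : ∀ x, ∑ k ∈ s, heatNode lam N k * (φ k x * φ k x) ≤ κ₃ * N ^ q := by
    intro x
    refine le_trans ?_ (h.tsum_abs_node_le hN x x)
    refine le_trans (Finset.sum_le_sum fun k _ => ?_)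
      ((h.summable_node hN x x).abs.sum_le_tsum s fun k _ => abs_nonneg _)
    rw [← mul_assoc]
    exact le_abs_self _
  calc _ ≤ ∫ x, κ₃ * N ^ q ∂μ :=
        integral_mono (integrable_finsetSum _ fun k _ => (h.integrable_mul k k).const_mul _)
          (integrable_const _) hle
    _ = _ := by simp

theorem IsDataDefinedSpace.integral_abs_le_one (h : IsDataDefinedSpace ρ μ lam φ q κ₁ κ₂ κ₃ κ₄)
    (k : ℕ) : ∫ x, |φ k x| ∂μ ≤ 1 := by
  calc ∫ x, |φ k x| ∂μ ≤ ∫ x, ((1 / 2 : ℝ) + (1 / 2) * (φ k x * φ k x)) ∂μ := by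
        refine integral_mono (h.integrable k).abs
          ((integrable_const _).add ((h.integrable_mul k k).const_mul _)) fun x => ?_
        have := sq_abs (φ k x)
        simp only
        nlinarith [sq_nonneg (|φ k x| - 1)]
    _ = 1 := by
        rw [integral_add (integrable_const _) ((h.integrable_mul k k).const_mul _),
          integral_const_mul, h.φ_orthonormal k k]
        norm_num

/-- The heat kernel is conservative. -/
theorem IsDataDefinedSpace.integral_heat (h : IsDataDefinedSpace ρ μ lam φ q κ₁ κ₂ κ₃ κ₄)
    {N : ℝ} (hN : 1 ≤ N) (x : X) : ∫ y, ∑' k, heatNode lam N k * φ k x * φ k y ∂μ = 1 := by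
  have hint : ∀ k, Integrable (fun y => heatNode lam N k * φ k x * φ k y) μ :=
    fun k => (h.integrable k).const_mul _
  have hs : Summable fun k => ∫ y, ‖heatNode lam N k * φ k x * φ k y‖ ∂μ := by
    have hb := ((h.summable_heatNode hN).add (h.summable_node hN x x)).mul_left (1 / 2)
    refine Summable.of_nonneg_of_le (fun k => integral_nonneg fun y => norm_nonneg _)
      (fun k => ?_) hb
    simp only [norm_mul, Real.norm_eq_abs]
    rw [integral_const_mul]
    have h0 := (heatNode_pos lam N k).le
    rw [abs_of_nonneg h0]
    calc _ ≤ heatNode lam N k * |φ k x| * 1 := by gcongr; exact h.integral_abs_le_one k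
      _ ≤ heatNode lam N k * ((1 / 2) * (1 + φ k x * φ k x)) := by
          rw [mul_one]
          gcongr
          have := sq_abs (φ k x)
          nlinarith [sq_nonneg (|φ k x| - 1)]
      _ = _ := by ring
  have := hasSum_integral_of_summable_integral_norm hint hs
  -- Only the constant eigenfunction has nonzero mean, and its eigenvalue 0 gives heat multiplier 1.
  rw [← this.tsum_eq, tsum_eq_single 0]
  · rw [integral_const_mul]
    have := h.φ_orthonormal 0 0
    simp only [h.φ_zero, mul_one, if_true] at this ⊢
    rw [this]
    simp [heatNode, h.lam_zero]
  · intro k hk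
    rw [integral_const_mul]
    have := h.φ_orthonormal 0 k
    simp only [h.φ_zero, mul_one, if_neg hk.symm] at this
    rw [this, mul_zero]

end Geometry

/-! ### Lower volume bounds, bounded diameter, compactness and coverings. -/

section Volume

variable {X : Type*} {ρ : X → X → ℝ} {κ₁ : ℝ} [TopologicalSpace X] [MeasurableSpace X]
  [OpensMeasurableSpace X] {μ : Measure X} [IsProbabilityMeasure μ]
  {lam : ℕ → ℝ} {φ : ℕ → X → ℝ} {q κ₂ κ₃ κ₄ : ℝ}

/-- Lower bound for the volume of balls. -/
theorem IsDataDefinedSpace.exists_volume_lower (h : IsDataDefinedSpace ρ μ lam φ q κ₁ κ₂ κ₃ κ₄) :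
    ∃ v : ℝ, 0 < v ∧ ∀ (x : X) (d : ℝ), 0 < d → d ≤ 1 →
      ENNReal.ofReal (v * d ^ q) ≤ μ (cball ρ x d) := by
  obtain ⟨S, hS⟩ := exists_nat_ge (q + 1)
  have hκ₂ := h.κ₂_pos
  have hκ₃ := h.κ₃_pos
  have hκ₄ := h.κ₄_pos
  set A : ℝ := 2 ^ (S + 1) * (κ₃ * (S.factorial * Real.exp 1)) * κ₂ with hA
  have hA0 : 0 < A := by positivity
  -- With N = Λ/d, points outside the ball have a = Nρ ≥ Λ, so κ₄a² ≥ 2a ≥ a + Λ. The spare e^(-Λ)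
  -- makes the far part of the unit heat mass at most 1/2; the remaining half lies in the ball,
  -- where the kernel is at most κ₃N^q.
  obtain ⟨Λ, hΛ1, hΛκ, hΛA⟩ : ∃ Λ : ℝ, 1 ≤ Λ ∧ 2 ≤ κ₄ * Λ ∧ A * Real.exp (-Λ) ≤ 1 / 2 := by
    refine ⟨max 1 (max (2 / κ₄) (2 * A)), le_max_left _ _, ?_, ?_⟩
    · have : 2 / κ₄ ≤ max 1 (max (2 / κ₄) (2 * A)) :=
        (le_max_left _ _).trans (le_max_right _ _)
      rw [div_le_iff₀ hκ₄] at this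
      linarith
    · set Λ := max 1 (max (2 / κ₄) (2 * A))
      have h1 : 2 * A ≤ Λ := (le_max_right _ _).trans (le_max_right _ _)
      have h2 := Real.add_one_le_exp Λ
      rw [Real.exp_neg, ← div_eq_mul_inv, div_le_iff₀ (Real.exp_pos _)]
      linarith
  refine ⟨1 / (2 * κ₃ * Λ ^ q), by positivity, fun x d hd hd1 => ?_⟩
  set N := Λ / d with hNdef
  have hN : 1 ≤ N := by rw [le_div_iff₀ hd]; linarith
  have hN0 : 0 < N := by linarith
  have hNq : 0 < N ^ q := Real.rpow_pos_of_pos hN0 q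
  have hdN : Λ / N = d := by rw [hNdef]; field_simp
  set K : X → ℝ := fun y => ∑' k, heatNode lam N k * φ k x * φ k y with hKdef
  have hK : ∀ y, |K y| ≤ κ₃ * N ^ q * Real.exp (-κ₄ * (N * ρ x y) ^ 2) := by
    intro y
    have := h.abs_tsum_node_pow_le hN x y le_rfl le_rfl
      (by rw [Nat.cast_one]; exact one_le_pow₀ hN)
    simpa using this
  have h1 : (1 : ℝ≥0∞) ≤ ∫⁻ y, ‖K y‖ₑ ∂μ := by
    have := enorm_integral_le_lintegral_enorm (μ := μ) K
    rwa [h.integral_heat hN x, enorm_one] at this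
  classical
  set K' : X → ℝ := fun y => if ρ x y ≤ d then 0 else K y with hK'
  have hsplit : ∀ y, ‖K y‖ₑ ≤
      (cball ρ x d).indicator (fun _ => ENNReal.ofReal (κ₃ * N ^ q)) y + ‖K' y‖ₑ := by
    intro y
    by_cases hy : ρ x y ≤ d
    · rw [Set.indicator_of_mem (by exact hy), Real.enorm_eq_ofReal_abs]
      refine le_add_right (ENNReal.ofReal_le_ofReal ((hK y).trans ?_))
      refine mul_le_of_le_one_right (by positivity) ?_
      rw [Real.exp_le_one_iff]
      nlinarith [sq_nonneg (N * ρ x y)]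
    · simp [hK', hy]
  have hfar : ∫⁻ y, ‖K' y‖ₑ ∂μ ≤ 1 / 2 := by
    have hb : ∀ y, |K' y| * (1 + N * ρ x y) ^ S ≤
        κ₃ * N ^ q * (S.factorial * Real.exp 1) * Real.exp (-Λ) := by
      intro y
      by_cases hy : ρ x y ≤ d
      · simp only [hK', hy, if_true, abs_zero, zero_mul]
        positivity
      · simp only [hK', hy, if_false]
        set a := N * ρ x y
        have ha : Λ ≤ a := by
          have : N * d ≤ N * ρ x y := by gcongr; exact (not_le.1 hy).le
          rwa [← hdN, mul_div_cancel₀ _ hN0.ne'] at this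
        have ha0 : 0 ≤ a := by linarith
        have e1 : Real.exp (-κ₄ * a ^ 2) ≤ Real.exp (-a) * Real.exp (-Λ) := by
          rw [← Real.exp_add]
          gcongr
          nlinarith [mul_le_mul_of_nonneg_left ha hκ₄.le]
        calc |K y| * (1 + a) ^ S
            ≤ (κ₃ * N ^ q * (Real.exp (-a) * Real.exp (-Λ))) * (1 + a) ^ S := by
              gcongr
              exact (hK y).trans (by gcongr)
          _ = κ₃ * N ^ q * ((1 + a) ^ S * Real.exp (-a)) * Real.exp (-Λ) := by ring
          _ ≤ _ := by
              gcongr κ₃ * N ^ q * ?_ * Real.exp (-Λ)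
              exact one_add_pow_mul_exp_neg_le ha0 S
    refine (lintegral_le_of_localized h.measurableSet_cball hS μ
      (ENNReal.ofReal (κ₂ * N ^ (-q))) hN0 h.quasiMetric.nonneg x K' hb (fun j => ?_)).trans ?_
    · refine (h.measure_ball_le x _ (by positivity)).trans ?_
      rw [← ENNReal.ofReal_mul (by positivity)]
      apply ENNReal.ofReal_le_ofReal
      rw [Real.div_rpow (by positivity) hN0.le, Real.rpow_neg hN0.le]
      apply le_of_eq; ring
    · rw [← ENNReal.ofReal_mul (by positivity)]
      have : (1 / 2 : ℝ≥0∞) = ENNReal.ofReal (1 / 2) := by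
        rw [ENNReal.ofReal_div_of_pos two_pos]; simp
      rw [this]
      apply ENNReal.ofReal_le_ofReal
      have hNN : N ^ q * N ^ (-q) = 1 := by rw [← Real.rpow_add hN0]; simp
      calc _ = A * Real.exp (-Λ) * (N ^ q * N ^ (-q)) := by rw [hA]; ring
        _ ≤ _ := by rw [hNN, mul_one]; exact hΛA
  have h2 : (1 : ℝ≥0∞) ≤ ENNReal.ofReal (κ₃ * N ^ q) * μ (cball ρ x d) + 1 / 2 := by
    calc (1 : ℝ≥0∞) ≤ _ := h1
      _ ≤ _ := lintegral_mono hsplit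
      _ = ENNReal.ofReal (κ₃ * N ^ q) * μ (cball ρ x d) + ∫⁻ y, ‖K' y‖ₑ ∂μ := by
          rw [lintegral_add_left (measurable_const.indicator (h.measurableSet_cball x d hd)),
            lintegral_indicator_const (h.measurableSet_cball x d hd)]
      _ ≤ _ := by gcongr
  have h3 : (1 : ℝ) ≤ κ₃ * N ^ q * (μ (cball ρ x d)).toReal + 1 / 2 := by
    have hfin : ENNReal.ofReal (κ₃ * N ^ q) * μ (cball ρ x d) ≠ ⊤ := by finiteness
    have := ENNReal.toReal_mono (by finiteness) h2
    rw [ENNReal.toReal_add hfin (by finiteness), ENNReal.toReal_mul,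
      ENNReal.toReal_ofReal (by positivity)] at this
    simpa using this
  rw [ENNReal.ofReal_le_iff_le_toReal (by finiteness)]
  have hNd : N ^ q * d ^ q = Λ ^ q := by
    rw [← Real.mul_rpow hN0.le hd.le, hNdef, div_mul_cancel₀ _ hd.ne']
  have hdq : 0 < d ^ q := by positivity
  have hΛq : 0 < Λ ^ q := by positivity
  rw [one_div, ← hNd, inv_mul_le_iff₀ (by positivity)]
  nlinarith [mul_le_mul_of_nonneg_left h3 hdq.le]

/-- Some ball about a base point has mass exceeding 1 - v. A unit ball of mass at least v cannot be
disjoint from it, which limits how far its centre can be. -/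
theorem IsDataDefinedSpace.exists_bounded (h : IsDataDefinedSpace ρ μ lam φ q κ₁ κ₂ κ₃ κ₄) :
    ∃ D : ℝ, ∀ x y, ρ x y ≤ D := by
  obtain ⟨v, hv, hvol⟩ := h.exists_volume_lower
  obtain ⟨x₀⟩ : Nonempty X := nonempty_of_isProbabilityMeasure μ
  have hκ := h.quasiMetric.one_le_const
  have hmono : Monotone fun n : ℕ => cball ρ x₀ ((n : ℝ) + 1) := by
    intro a b hab y hy
    have : (a : ℝ) ≤ b := by exact_mod_cast hab
    simp only [cball, Set.mem_ofPred_eq] at hy ⊢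
    linarith
  have hU : ⋃ n : ℕ, cball ρ x₀ ((n : ℝ) + 1) = Set.univ := by
    refine Set.eq_univ_of_forall fun y => Set.mem_iUnion.2 ?_
    obtain ⟨n, hn⟩ := exists_nat_ge (ρ x₀ y)
    exact ⟨n, by simp only [cball, Set.mem_ofPred_eq]; linarith⟩
  have hlim := tendsto_measure_iUnion_atTop (μ := μ) hmono
  rw [hU, measure_univ] at hlim
  have hlt : (1 : ℝ≥0∞) - ENNReal.ofReal v < 1 :=
    ENNReal.sub_lt_self ENNReal.one_ne_top one_ne_zero (by simpa using hv)
  obtain ⟨n, hn⟩ := (hlim.eventually (lt_mem_nhds hlt)).exists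
  have key : ∀ x, ρ x x₀ ≤ κ₁ * (1 + (n + 1)) := by
    intro x
    by_contra hcon
    have hdisj : Disjoint (cball ρ x₀ ((n : ℝ) + 1)) (cball ρ x 1) := by
      rw [Set.disjoint_left]
      intro z hz1 hz2
      simp only [cball, Set.mem_ofPred_eq] at hz1 hz2
      apply hcon
      refine (h.quasiMetric.triangle x x₀ z).trans ?_
      rw [h.quasiMetric.symm z x₀]
      gcongr
    have h1 := measure_union (μ := μ) hdisj (h.measurableSet_cball x 1 one_pos)
    have h2 : μ (cball ρ x₀ ((n : ℝ) + 1) ∪ cball ρ x 1) ≤ 1 := prob_le_one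
    have h3 := hvol x 1 one_pos le_rfl
    rw [Real.one_rpow, mul_one] at h3
    rw [h1] at h2
    have h4 : μ (cball ρ x₀ ((n : ℝ) + 1)) + ENNReal.ofReal v ≤ 1 := le_trans (by gcongr) h2
    have h5 := ENNReal.le_sub_of_add_le_right ENNReal.ofReal_ne_top h4
    exact absurd hn (not_lt.2 h5)
  refine ⟨κ₁ * (κ₁ * (1 + (n + 1)) + κ₁ * (1 + (n + 1))), fun x y => ?_⟩
  refine (h.quasiMetric.triangle x y x₀).trans ?_
  rw [h.quasiMetric.symm x₀ y]
  have := key x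
  have := key y
  gcongr

theorem IsDataDefinedSpace.compactSpace (h : IsDataDefinedSpace ρ μ lam φ q κ₁ κ₂ κ₃ κ₄) :
    CompactSpace X := by
  obtain ⟨D, hD⟩ := h.exists_bounded
  obtain ⟨x₀⟩ : Nonempty X := nonempty_of_isProbabilityMeasure μ
  refine ⟨?_⟩
  have h0 : 0 ≤ D := (h.quasiMetric.nonneg x₀ x₀).trans (hD x₀ x₀)
  have : cball ρ x₀ (D + 1) = Set.univ :=
    Set.eq_univ_of_forall fun y => by
      simp only [cball, Set.mem_ofPred_eq]; linarith [hD x₀ y]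
  rw [← this]
  exact h.isCompact_ball x₀ _ (by linarith)

/-- The compact balls about a point shrink to that point, so one of them lies in any given
neighbourhood, and balls have positive mass. This is what makes continuous representatives unique.
-/
theorem IsDataDefinedSpace.isOpenPosMeasure (h : IsDataDefinedSpace ρ μ lam φ q κ₁ κ₂ κ₃ κ₄) :
    μ.IsOpenPosMeasure := by
  obtain ⟨v, hv, hvol⟩ := h.exists_volume_lower
  refine ⟨fun U hU ⟨y, hy⟩ hU0 => ?_⟩
  have hpos : ∀ n : ℕ, (0 : ℝ) < 1 / (n + 1) := fun n => by positivity
  have hanti : Antitone fun n : ℕ => cball ρ y (1 / ((n : ℝ) + 1)) := by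
    intro a b hab z hz
    simp only [cball, Set.mem_ofPred_eq] at hz ⊢
    refine hz.trans ?_
    gcongr
  obtain ⟨n, hn⟩ := exists_subset_nhds_of_isCompact' (V := fun n : ℕ => cball ρ y (1 / ((n : ℝ) + 1)))
    hanti.directed_ge (fun n => h.isCompact_ball y _ (hpos n)) (fun n => h.isClosed_cball y (hpos n))
    (U := U) (fun z hz => by
      have : ρ y z ≤ 0 := by
        refine ge_of_tendsto' (tendsto_one_div_add_atTop_nhds_zero_nat (𝕜 := ℝ)) fun n => ?_
        exact Set.mem_iInter.1 hz n
      have := (h.quasiMetric.eq_zero_iff y z).1 (le_antisymm this (h.quasiMetric.nonneg y z))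
      exact this ▸ hU.mem_nhds hy)
  have h1 := hvol y (1 / (n + 1)) (hpos n)
    (by rw [div_le_one (by positivity)]; linarith [(Nat.cast_nonneg n : (0 : ℝ) ≤ n)])
  have h2 := h1.trans ((measure_mono hn).trans hU0.le)
  have : 0 < v * (1 / ((n : ℝ) + 1)) ^ q := mul_pos hv (Real.rpow_pos_of_pos (hpos n) q)
  simp only [nonpos_iff_eq_zero, ENNReal.ofReal_eq_zero] at h2
  linarith

/-- A bound for a measure on balls of one radius gives bounds for all larger radii. -/
theorem IsDataDefinedSpace.exists_measure_ball_le
    (h : IsDataDefinedSpace ρ μ lam φ q κ₁ κ₂ κ₃ κ₄) :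
    ∃ C : ℝ, 0 ≤ C ∧ ∀ (m : Measure X) (M : ℝ≥0∞) (d R : ℝ), 0 < d → d ≤ 1 → d ≤ R →
      (∀ x, m (cball ρ x d) ≤ M) → ∀ x, m (cball ρ x R) ≤ ENNReal.ofReal (C * (R / d) ^ q) * M := by
  obtain ⟨v, hv, hvol⟩ := h.exists_volume_lower
  have hκ := h.quasiMetric.one_le_const
  have hκ0 : 0 < κ₁ := by linarith
  have hκ₂ := h.κ₂_pos
  have hq := h.q_pos
  refine ⟨κ₂ * (4 * κ₁ ^ 2) ^ q / v, by positivity, fun m M d R hd hd1 hdR hm x => ?_⟩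
  have hR : 0 < R := by linarith
  -- Half the separation up to the quasi-metric constant: balls of radius `e` about d-separated
  -- centres are disjoint.
  set e := d / (2 * κ₁) with he
  have he0 : 0 < e := by positivity
  have hed : e ≤ d := by rw [he, div_le_iff₀ (by positivity)]; nlinarith
  set P : Finset X → Prop := fun F => (∀ z ∈ F, ρ x z ≤ R) ∧
    ∀ z ∈ F, ∀ w ∈ F, z ≠ w → d < ρ z w with hP
  have hcard : ∀ F, P F → (F.card : ℝ) ≤ κ₂ * (4 * κ₁ ^ 2) ^ q / v * (R / d) ^ q := by
    intro F hF
    have hdisj : Set.PairwiseDisjoint (F : Set X) fun z => cball ρ z e := by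
      intro z hz w hw hzw
      refine Set.disjoint_left.2 fun y hy1 hy2 => ?_
      simp only [cball, Set.mem_ofPred_eq] at hy1 hy2
      have h1 := hF.2 z hz w hw hzw
      have h2 := h.quasiMetric.triangle z w y
      rw [h.quasiMetric.symm y w] at h2
      have h3 : κ₁ * (ρ z y + ρ w y) ≤ κ₁ * (e + e) := by gcongr
      have h4 : κ₁ * (e + e) = d := by rw [he]; field_simp; ring
      linarith
    have hsub : ⋃ z ∈ F, cball ρ z e ⊆ cball ρ x (2 * κ₁ * R) := by
      intro y hy
      simp only [Set.mem_iUnion] at hy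
      obtain ⟨z, hz, hy⟩ := hy
      simp only [cball, Set.mem_ofPred_eq] at hy ⊢
      calc ρ x y ≤ κ₁ * (ρ x z + ρ z y) := h.quasiMetric.triangle x y z
        _ ≤ κ₁ * (R + R) := by
            have := hF.1 z hz
            gcongr
            linarith
        _ = _ := by ring
    have h1 : ∑ z ∈ F, μ (cball ρ z e) ≤ ENNReal.ofReal (κ₂ * (2 * κ₁ * R) ^ q) := by
      rw [← measure_biUnion_finset hdisj fun z _ => h.measurableSet_cball z e he0]
      exact (measure_mono hsub).trans (h.measure_ball_le x _ (by positivity))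
    have h2 : (F.card : ℝ≥0∞) * ENNReal.ofReal (v * e ^ q) ≤ ∑ z ∈ F, μ (cball ρ z e) := by
      rw [← nsmul_eq_mul]
      exact Finset.card_nsmul_le_sum _ _ _ fun z _ => hvol z e he0 (hed.trans hd1)
    have h3 := h2.trans h1
    rw [← ENNReal.ofReal_natCast, ← ENNReal.ofReal_mul (by positivity),
      ENNReal.ofReal_le_ofReal_iff (by positivity)] at h3
    have h4 : (4 * κ₁ ^ 2) ^ q * (R / d) ^ q * e ^ q = (2 * κ₁ * R) ^ q := by
      rw [← Real.mul_rpow (by positivity) (by positivity),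
        ← Real.mul_rpow (by positivity) (by positivity)]
      congr 1
      rw [he]; field_simp; ring
    rw [← h4] at h3
    have heq : 0 < e ^ q := by positivity
    rw [div_mul_eq_mul_div, le_div_iff₀ hv]
    nlinarith
  -- Volume comparison bounds the size of d-separated subsets, so a largest one exists; its d-balls
  -- cover, since an uncovered point could be added.
  obtain ⟨F, hF, hmax⟩ : ∃ F, P F ∧ ∀ F', P F' → F'.card ≤ F.card := by
    set T : Set ℕ := {n | ∃ F, P F ∧ F.card = n}
    have hT : T.Nonempty := ⟨0, ∅, by simp [hP], rfl⟩
    have hTb : BddAbove T := by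
      refine ⟨⌊κ₂ * (4 * κ₁ ^ 2) ^ q / v * (R / d) ^ q⌋₊, ?_⟩
      rintro n ⟨F, hF, rfl⟩
      exact Nat.le_floor (hcard F hF)
    obtain ⟨F, hF, hFc⟩ := Nat.sSup_mem hT hTb
    exact ⟨F, hF, fun F' hF' => hFc ▸ le_csSup hTb ⟨F', hF', rfl⟩⟩
  have hcover : cball ρ x R ⊆ ⋃ z ∈ F, cball ρ z d := by
    classical
    intro y hy
    by_contra hcon
    simp only [Set.mem_iUnion, not_exists, cball, Set.mem_ofPred_eq, not_le] at hcon hy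
    have hyF : y ∉ F := fun hyF => by
      have := hcon y hyF
      rw [(h.quasiMetric.eq_zero_iff y y).2 rfl] at this
      linarith
    have := hmax (insert y F) ⟨?_, ?_⟩
    · rw [Finset.card_insert_of_notMem hyF] at this
      omega
    · intro z hz
      rcases Finset.mem_insert.1 hz with rfl | hz
      exacts [hy, hF.1 z hz]
    · intro z hz w hw hzw
      rcases Finset.mem_insert.1 hz with hz' | hz' <;>
        rcases Finset.mem_insert.1 hw with hw' | hw'
      · exact absurd (hz'.trans hw'.symm) hzw
      · rw [h.quasiMetric.symm, hz']; exact hcon w hw'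
      · rw [hw']; exact hcon z hz'
      · exact hF.2 z hz' w hw' hzw
  calc m (cball ρ x R) ≤ m (⋃ z ∈ F, cball ρ z d) := measure_mono hcover
    _ ≤ ∑ z ∈ F, m (cball ρ z d) := measure_biUnion_finset_le _ _
    _ ≤ ∑ z ∈ F, M := Finset.sum_le_sum fun z _ => hm z
    _ = (F.card : ℝ≥0∞) * M := by simp
    _ ≤ _ := by
        gcongr
        rw [← ENNReal.ofReal_natCast]
        exact ENNReal.ofReal_le_ofReal (hcard F hF)

end Volume

/-! ### L^p bounds for finite spectral multipliers. -/

section Multiplier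

set_option linter.unusedSectionVars false

variable {X : Type*} [MeasurableSpace X] {𝕜 : Type*} [RCLike 𝕜]

/-- The finite spectral multiplier `f ↦ ∑ₖ mₖ f̂(k) φₖ`. -/
def multOp (μ : Measure X) (φ : ℕ → X → ℝ) (s : Finset ℕ) (m : ℕ → ℝ) (f : X → 𝕜) : X → 𝕜 :=
  fun x => ∑ k ∈ s, ((m k : ℝ) : 𝕜) * coeff μ φ f k * ((φ k x : ℝ) : 𝕜)

/-- Hölder's inequality for the measure w dm, comparing L¹ with L^p by the total mass. This form
includes p = ∞, where the mass has exponent 1. -/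
theorem lintegral_weight_mul_le (m : Measure X) {w : X → ℝ≥0∞} (hw : AEMeasurable w m)
    {g : X → 𝕜} (hg : AEStronglyMeasurable g m) {p : ℝ≥0∞} (hp : 1 ≤ p) :
    ∫⁻ y, w y * ‖g y‖ₑ ∂m ≤
      eLpNorm g p (m.withDensity w) * (∫⁻ y, w y ∂m) ^ (1 - (p⁻¹).toReal) := by
  have h1 := eLpNorm_le_eLpNorm_mul_rpow_measure_univ (μ := m.withDensity w) hp
    (hg.mono_ac (withDensity_absolutelyContinuous m w))
  rw [eLpNorm_one_eq_lintegral_enorm, lintegral_withDensity_eq_lintegral_mul₀ hw hg.enorm,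
    withDensity_apply _ MeasurableSet.univ, setLIntegral_univ] at h1
  simpa [ENNReal.toReal_inv] using h1

variable [TopologicalSpace X] [OpensMeasurableSpace X] {ρ : X → X → ℝ} {μ : Measure X}
  [IsProbabilityMeasure μ] {lam : ℕ → ℝ} {φ : ℕ → X → ℝ} {q κ₁ κ₂ κ₃ κ₄ : ℝ}

theorem IsDataDefinedSpace.integrable_mul_eigen (h : IsDataDefinedSpace ρ μ lam φ q κ₁ κ₂ κ₃ κ₄)
    {f : X → 𝕜} (hf : Integrable f μ) (k : ℕ) :
    Integrable (fun x => f x * ((φ k x : ℝ) : 𝕜)) μ := by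
  obtain ⟨M, hM⟩ := h.φ_bounded k
  refine hf.mul_bdd (c := M)
    (RCLike.continuous_ofReal.comp (h.φ_continuous k)).aestronglyMeasurable (ae_of_all _ fun x => ?_)
  simpa using hM x

theorem IsDataDefinedSpace.coeff_sub (h : IsDataDefinedSpace ρ μ lam φ q κ₁ κ₂ κ₃ κ₄)
    {f g : X → 𝕜} (hf : Integrable f μ) (hg : Integrable g μ) (k : ℕ) :
    coeff μ φ (f - g) k = coeff μ φ f k - coeff μ φ g k := by
  unfold coeff
  rw [← integral_sub (h.integrable_mul_eigen hf k) (h.integrable_mul_eigen hg k)]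
  simp [sub_mul]

theorem IsDataDefinedSpace.coeff_add (h : IsDataDefinedSpace ρ μ lam φ q κ₁ κ₂ κ₃ κ₄)
    {f g : X → 𝕜} (hf : Integrable f μ) (hg : Integrable g μ) (k : ℕ) :
    coeff μ φ (f + g) k = coeff μ φ f k + coeff μ φ g k := by
  unfold coeff
  rw [← integral_add (h.integrable_mul_eigen hf k) (h.integrable_mul_eigen hg k)]
  simp [add_mul]

theorem coeff_smul (c : 𝕜) (f : X → 𝕜) (k : ℕ) :
    coeff μ φ (c • f) k = c * coeff μ φ f k := by
  unfold coeff
  rw [← integral_const_mul]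
  simp [mul_assoc]

theorem IsDataDefinedSpace.multOp_sub (h : IsDataDefinedSpace ρ μ lam φ q κ₁ κ₂ κ₃ κ₄)
    {f g : X → 𝕜} (hf : Integrable f μ) (hg : Integrable g μ) (s : Finset ℕ) (m : ℕ → ℝ) :
    multOp μ φ s m (f - g) = multOp μ φ s m f - multOp μ φ s m g := by
  funext x
  simp only [multOp, Pi.sub_apply, h.coeff_sub hf hg, ← Finset.sum_sub_distrib]
  exact Finset.sum_congr rfl fun k _ => by ring

theorem IsDataDefinedSpace.coeff_eigen (h : IsDataDefinedSpace ρ μ lam φ q κ₁ κ₂ κ₃ κ₄)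
    (j k : ℕ) : coeff μ φ (fun x => ((φ j x : ℝ) : 𝕜)) k = if j = k then 1 else 0 := by
  unfold coeff
  have : ∀ x, ((φ j x : ℝ) : 𝕜) * ((φ k x : ℝ) : 𝕜) = ((φ k x * φ j x : ℝ) : 𝕜) := by
    intro x; push_cast; ring
  simp_rw [this]
  rw [integral_ofReal, h.φ_orthonormal j k]
  split_ifs <;> simp

theorem IsDataDefinedSpace.multOp_eq_integral (h : IsDataDefinedSpace ρ μ lam φ q κ₁ κ₂ κ₃ κ₄)
    {f : X → 𝕜} (hf : Integrable f μ) (s : Finset ℕ) (m : ℕ → ℝ) (x : X) :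
    multOp μ φ s m f x = ∫ y, ((multKernel φ s m x y : ℝ) : 𝕜) * f y ∂μ := by
  have : ∀ y, ((multKernel φ s m x y : ℝ) : 𝕜) * f y
      = ∑ k ∈ s, (((m k * φ k x : ℝ) : 𝕜) * (f y * ((φ k y : ℝ) : 𝕜))) := by
    intro y
    rw [multKernel]
    push_cast
    rw [Finset.sum_mul]
    exact Finset.sum_congr rfl fun k _ => by ring
  simp_rw [this]
  rw [integral_finsetSum _ fun k _ => (h.integrable_mul_eigen hf k).const_mul _]
  refine Finset.sum_congr rfl fun k _ => ?_
  rw [integral_const_mul, coeff]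
  push_cast
  ring

theorem IsDataDefinedSpace.enorm_multOp_le (h : IsDataDefinedSpace ρ μ lam φ q κ₁ κ₂ κ₃ κ₄)
    {f : X → 𝕜} (hf : Integrable f μ) (s : Finset ℕ) (m : ℕ → ℝ) (x : X) :
    ‖multOp μ φ s m f x‖ₑ ≤ ∫⁻ y, ‖multKernel φ s m x y‖ₑ * ‖f y‖ₑ ∂μ := by
  rw [h.multOp_eq_integral hf]
  refine (enorm_integral_le_lintegral_enorm _).trans (le_of_eq ?_)
  refine lintegral_congr fun y => ?_
  rw [enorm_mul]
  congr 1
  rw [← ofReal_norm, ← ofReal_norm]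
  simp

theorem IsDataDefinedSpace.continuous_multOp (h : IsDataDefinedSpace ρ μ lam φ q κ₁ κ₂ κ₃ κ₄)
    (f : X → 𝕜) (s : Finset ℕ) (m : ℕ → ℝ) : Continuous (multOp μ φ s m f) :=
  continuous_finsetSum _ fun k _ =>
    continuous_const.mul (RCLike.continuous_ofReal.comp (h.φ_continuous k))

theorem IsDataDefinedSpace.memLp_of_continuous (h : IsDataDefinedSpace ρ μ lam φ q κ₁ κ₂ κ₃ κ₄)
    {g : X → 𝕜} (hg : Continuous g) (m : Measure X) [IsFiniteMeasure m] (p : ℝ≥0∞) :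
    MemLp g p m := by
  have := h.compactSpace
  obtain ⟨C, hC⟩ := isCompact_univ.exists_bound_of_continuousOn hg.continuousOn
  exact MemLp.of_bound hg.aestronglyMeasurable C (ae_of_all _ fun x => hC x trivial)

theorem IsDataDefinedSpace.integrable_of_continuous
    (h : IsDataDefinedSpace ρ μ lam φ q κ₁ κ₂ κ₃ κ₄)
    {g : X → 𝕜} (hg : Continuous g) (m : Measure X) [IsFiniteMeasure m] : Integrable g m :=
  memLp_one_iff_integrable.1 (h.memLp_of_continuous hg m 1)

theorem IsDataDefinedSpace.coeff_multOp (h : IsDataDefinedSpace ρ μ lam φ q κ₁ κ₂ κ₃ κ₄)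
    (f : X → 𝕜) (s : Finset ℕ) (m : ℕ → ℝ) (k : ℕ) :
    coeff μ φ (multOp μ φ s m f) k = if k ∈ s then ((m k : ℝ) : 𝕜) * coeff μ φ f k else 0 := by
  have hi : ∀ j, Integrable (fun x => ((φ j x : ℝ) : 𝕜) * ((φ k x : ℝ) : 𝕜)) μ := fun j =>
    h.integrable_mul_eigen (h.integrable j).ofReal k
  have e : coeff μ φ (multOp μ φ s m f) k = ∑ j ∈ s, ((m j : ℝ) : 𝕜) * coeff μ φ f j *
      coeff μ φ (fun x => ((φ j x : ℝ) : 𝕜)) k := by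
    conv_lhs => unfold coeff multOp
    simp_rw [Finset.sum_mul, mul_assoc _ ((φ _ _ : ℝ) : 𝕜)]
    rw [integral_finsetSum _ fun j _ => (hi j).const_mul _]
    refine Finset.sum_congr rfl fun j _ => ?_
    rw [integral_const_mul]
    rfl
  rw [e]
  simp_rw [h.coeff_eigen, mul_ite, mul_one, mul_zero]
  rw [Finset.sum_ite_eq' s k]

theorem IsDataDefinedSpace.measurable_multKernel (h : IsDataDefinedSpace ρ μ lam φ q κ₁ κ₂ κ₃ κ₄)
    (s : Finset ℕ) (m : ℕ → ℝ) : Measurable fun z : X × X => ‖multKernel φ s m z.1 z.2‖ₑ := by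
  refine Measurable.enorm ?_
  unfold multKernel
  exact Finset.measurable_sum _ fun k _ => (measurable_const.mul
    ((h.φ_continuous k).measurable.comp measurable_fst)).mul
    ((h.φ_continuous k).measurable.comp measurable_snd)

theorem multKernel_comm (φ : ℕ → X → ℝ) (s : Finset ℕ) (m : ℕ → ℝ) (x y : X) :
    multKernel φ s m x y = multKernel φ s m y x :=
  Finset.sum_congr rfl fun k _ => by ring

/-- Schur's test. -/
theorem IsDataDefinedSpace.eLpNorm_multOp_le (h : IsDataDefinedSpace ρ μ lam φ q κ₁ κ₂ κ₃ κ₄)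
    {p : ℝ≥0∞} (hp : 1 ≤ p) {f : X → 𝕜} (hf : MemLp f p μ) (s : Finset ℕ) (m : ℕ → ℝ)
    {C : ℝ≥0∞} (hC : ∀ x, ∫⁻ y, ‖multKernel φ s m x y‖ₑ ∂μ ≤ C) (hCt : C ≠ ⊤) :
    eLpNorm (multOp μ φ s m f) p μ ≤ C * eLpNorm f p μ := by
  have hfi := hf.integrable hp
  set w : X × X → ℝ≥0∞ := fun z => ‖multKernel φ s m z.1 z.2‖ₑ with hw
  have hwm : Measurable w := h.measurable_multKernel s m
  have hwx : ∀ x, Measurable fun y => w (x, y) := fun x => hwm.comp measurable_prodMk_left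
  have hexp : 0 ≤ 1 - (p⁻¹).toReal := by
    have : (p⁻¹).toReal ≤ 1 := by
      have := ENNReal.toReal_mono ENNReal.one_ne_top (ENNReal.inv_le_one.2 hp)
      simpa using this
    linarith
  have hpt : ∀ x, ‖multOp μ φ s m f x‖ₑ ≤
      eLpNorm f p (μ.withDensity fun y => w (x, y)) * C ^ (1 - (p⁻¹).toReal) := by
    intro x
    refine (h.enorm_multOp_le hfi s m x).trans
      ((lintegral_weight_mul_le μ (hwx x).aemeasurable hfi.aestronglyMeasurable hp).trans ?_)
    gcongr
    exact hC x
  rcases eq_or_ne p ⊤ with rfl | hpt'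
  · rw [eLpNorm_exponent_top]
    refine eLpNormEssSup_le_of_ae_enorm_bound (ae_of_all _ fun x => ?_)
    refine (hpt x).trans ?_
    simp only [ENNReal.inv_top, ENNReal.toReal_zero, sub_zero, ENNReal.rpow_one,
      eLpNorm_exponent_top]
    rw [mul_comm]
    gcongr
    exact withDensity_absolutelyContinuous _ _
  · have hp0 : p ≠ 0 := (zero_lt_one.trans_le hp).ne'
    have hpr : 0 < p.toReal := ENNReal.toReal_pos hp0 hpt'
    have hpr1 : 1 ≤ p.toReal := by
      have := ENNReal.toReal_mono hpt' hp
      simpa using this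
    have hfm : AEMeasurable (fun y => ‖f y‖ₑ ^ p.toReal) μ := hf.1.enorm.pow_const _
    have hpow : ∀ x, ‖multOp μ φ s m f x‖ₑ ^ p.toReal ≤
        (∫⁻ y, w (x, y) * ‖f y‖ₑ ^ p.toReal ∂μ) * C ^ (p.toReal - 1) := by
      intro x
      calc _ ≤ (eLpNorm f p (μ.withDensity fun y => w (x, y)) * C ^ (1 - (p⁻¹).toReal))
            ^ p.toReal := by gcongr; exact hpt x
        _ = _ := by
          rw [ENNReal.mul_rpow_of_nonneg _ _ hpr.le, eLpNorm_eq_lintegral_rpow_enorm_toReal hp0 hpt',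
            ← ENNReal.rpow_mul, ← ENNReal.rpow_mul, one_div, inv_mul_cancel₀ hpr.ne',
            ENNReal.rpow_one, lintegral_withDensity_eq_lintegral_mul₀ (hwx x).aemeasurable hfm]
          congr 2
          rw [ENNReal.toReal_inv, sub_mul, inv_mul_cancel₀ hpr.ne', one_mul]
    rw [eLpNorm_eq_lintegral_rpow_enorm_toReal hp0 hpt', one_div,
      ENNReal.rpow_inv_le_iff hpr, ENNReal.mul_rpow_of_nonneg _ _ hpr.le,
      eLpNorm_eq_lintegral_rpow_enorm_toReal hp0 hpt', one_div, ← ENNReal.rpow_mul,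
      inv_mul_cancel₀ hpr.ne', ENNReal.rpow_one]
    calc ∫⁻ x, ‖multOp μ φ s m f x‖ₑ ^ p.toReal ∂μ
        ≤ ∫⁻ x, (∫⁻ y, w (x, y) * ‖f y‖ₑ ^ p.toReal ∂μ) * C ^ (p.toReal - 1) ∂μ :=
          lintegral_mono hpow
      _ = (∫⁻ x, ∫⁻ y, w (x, y) * ‖f y‖ₑ ^ p.toReal ∂μ ∂μ) * C ^ (p.toReal - 1) := by
          rw [lintegral_mul_const' _ _ (ENNReal.rpow_ne_top_of_nonneg (by linarith) hCt)]
      _ = (∫⁻ y, ∫⁻ x, w (x, y) * ‖f y‖ₑ ^ p.toReal ∂μ ∂μ) * C ^ (p.toReal - 1) := by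
          rw [lintegral_lintegral_swap]
          exact hwm.aemeasurable.mul
            (hfm.comp_quasiMeasurePreserving Measure.quasiMeasurePreserving_snd)
      _ = (∫⁻ y, (∫⁻ x, w (x, y) ∂μ) * ‖f y‖ₑ ^ p.toReal ∂μ) * C ^ (p.toReal - 1) := by
          congr 1
          refine lintegral_congr fun y => ?_
          have hwy : Measurable fun x => w (x, y) := hwm.comp measurable_prodMk_right
          rw [lintegral_mul_const _ hwy]
      _ ≤ (∫⁻ y, C * ‖f y‖ₑ ^ p.toReal ∂μ) * C ^ (p.toReal - 1) := by
          gcongr with y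
          refine le_trans (le_of_eq (lintegral_congr fun x => ?_)) (hC y)
          simp only [hw]
          rw [multKernel_comm]
      _ = C ^ p.toReal * ∫⁻ y, ‖f y‖ₑ ^ p.toReal ∂μ := by
          rw [lintegral_const_mul' _ _ hCt, mul_right_comm]
          congr 1
          conv_lhs => rw [← ENNReal.rpow_one C]
          rw [ENNReal.rpow_one]
          nth_rewrite 1 [← ENNReal.rpow_one C]
          rw [← ENNReal.rpow_add_of_nonneg _ _ zero_le_one (by linarith)]
          congr 1
          ring

/-- The `L¹`-norm of a multiplier with respect to another measure. -/
theorem IsDataDefinedSpace.lintegral_multOp_le (h : IsDataDefinedSpace ρ μ lam φ q κ₁ κ₂ κ₃ κ₄)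
    {p : ℝ≥0∞} (hp : 1 ≤ p) {f : X → 𝕜} (hf : MemLp f p μ) (s : Finset ℕ) (m : ℕ → ℝ)
    (σ : Measure X) [IsFiniteMeasure σ]
    {C C' : ℝ≥0∞} (hC : ∀ x, ∫⁻ y, ‖multKernel φ s m x y‖ₑ ∂μ ≤ C)
    (hC' : ∀ x, ∫⁻ y, ‖multKernel φ s m x y‖ₑ ∂σ ≤ C') :
    ∫⁻ x, ‖multOp μ φ s m f x‖ₑ ∂σ ≤
      C' ^ (p⁻¹).toReal * eLpNorm f p μ * (C * σ Set.univ) ^ (1 - (p⁻¹).toReal) := by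
  have hfi := hf.integrable hp
  set w : X × X → ℝ≥0∞ := fun z => ‖multKernel φ s m z.1 z.2‖ₑ with hw
  have hwm : Measurable w := h.measurable_multKernel s m
  have hexp : 0 ≤ 1 - (p⁻¹).toReal := by
    have : (p⁻¹).toReal ≤ 1 := by
      have := ENNReal.toReal_mono ENNReal.one_ne_top (ENNReal.inv_le_one.2 hp)
      simpa using this
    linarith
  have hf2 : AEStronglyMeasurable (fun z : X × X => f z.2) (σ.prod μ) :=
    hf.1.comp_quasiMeasurePreserving Measure.quasiMeasurePreserving_snd
  -- Under `τ` the second marginal is at most C'μ, by symmetry of the kernel, while the total mass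
  -- is at most Cσ(X). Hölder on `τ` gives these two bounds the exponents 1/p and 1/p'.
  set τ := (σ.prod μ).withDensity w with hτ
  have hmap : τ.map Prod.snd ≤ C' • μ := by
    refine Measure.le_iff.2 fun A hA => ?_
    rw [Measure.map_apply measurable_snd hA, hτ, withDensity_apply _ (measurable_snd hA),
      ← lintegral_indicator (measurable_snd hA), lintegral_prod_symm _
        (hwm.indicator (measurable_snd hA)).aemeasurable, Measure.smul_apply, smul_eq_mul,
      ← lintegral_indicator_const hA]
    refine lintegral_mono fun y => ?_
    by_cases hy : y ∈ A
    · rw [Set.indicator_of_mem hy]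
      refine le_trans (lintegral_mono fun x => Set.indicator_le_self _ _ _) ?_
      refine le_trans (le_of_eq (lintegral_congr fun x => ?_)) (hC' y)
      simp only [hw]
      rw [multKernel_comm]
    · rw [Set.indicator_of_notMem hy]
      refine le_of_eq ?_
      rw [← lintegral_zero (μ := σ)]
      refine lintegral_congr fun x => ?_
      rw [Set.indicator_of_notMem (by exact hy)]
  have hac : τ.map Prod.snd ≪ μ :=
    (Measure.absolutelyContinuous_of_le hmap).trans Measure.smul_absolutelyContinuous
  have hnorm : eLpNorm (fun z : X × X => f z.2) p τ ≤ C' ^ (p⁻¹).toReal * eLpNorm f p μ := by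
    have e : eLpNorm (fun z : X × X => f z.2) p τ = eLpNorm f p (τ.map Prod.snd) :=
      (eLpNorm_map_measure (hf.1.mono_ac hac) measurable_snd.aemeasurable).symm
    rw [e]
    refine (eLpNorm_mono_measure f hmap).trans ((eLpNorm_smul_measure_le _ _ _ _).trans ?_)
    rw [one_div, smul_eq_mul]
  calc ∫⁻ x, ‖multOp μ φ s m f x‖ₑ ∂σ
      ≤ ∫⁻ x, ∫⁻ y, w (x, y) * ‖f y‖ₑ ∂μ ∂σ := lintegral_mono fun x => h.enorm_multOp_le hfi s m x
    _ = ∫⁻ z, w z * ‖f z.2‖ₑ ∂(σ.prod μ) := by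
        rw [lintegral_prod (fun z => w z * ‖f z.2‖ₑ) (hwm.aemeasurable.mul hf2.enorm)]
    _ ≤ eLpNorm (fun z : X × X => f z.2) p τ * (∫⁻ z, w z ∂(σ.prod μ)) ^ (1 - (p⁻¹).toReal) :=
        lintegral_weight_mul_le _ hwm.aemeasurable hf2 hp
    _ ≤ _ := by
        gcongr
        rw [lintegral_prod _ hwm.aemeasurable]
        calc _ ≤ ∫⁻ x, C ∂σ := lintegral_mono fun x => hC x
          _ = _ := lintegral_const _

end Multiplier

/-! ### Smooth cutoffs in the heat variable. -/

section Cutoff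

open scoped ContDiff

/-- A smooth cutoff function that vanishes for `u ≤ e⁻¹` and equals one for `u ≥ e^(-1/4)`. -/
def cutoff (u : ℝ) : ℝ :=
  Real.smoothTransition ((u - Real.exp (-1)) / (Real.exp (-(1 / 4)) - Real.exp (-1)))

theorem exp_neg_one_lt : Real.exp (-1) < Real.exp (-(1 / 4)) := by
  apply Real.exp_lt_exp.2; norm_num

theorem contDiff_cutoff : ContDiff ℝ ∞ cutoff :=
  Real.smoothTransition.contDiff.comp ((contDiff_id.sub contDiff_const).div_const _)

theorem cutoff_eq_zero {u : ℝ} (hu : u ≤ Real.exp (-1)) : cutoff u = 0 :=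
  Real.smoothTransition.zero_of_nonpos
    (div_nonpos_of_nonpos_of_nonneg (by linarith) (by linarith [exp_neg_one_lt]))

theorem cutoff_eq_one {u : ℝ} (hu : Real.exp (-(1 / 4)) ≤ u) : cutoff u = 1 := by
  refine Real.smoothTransition.one_of_one_le ?_
  rw [le_div_iff₀ (by linarith [exp_neg_one_lt])]
  linarith

/-- The difference of two consecutive dyadic dilations of the cutoff. -/
def bandCutoff (u : ℝ) : ℝ := cutoff u * (1 - cutoff (u ^ 4))

theorem bandCutoff_eq_zero {u : ℝ} (hu : u ≤ Real.exp (-1)) : bandCutoff u = 0 := by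
  rw [bandCutoff, cutoff_eq_zero hu, zero_mul]

theorem bandCutoff_eq_zero' {u : ℝ} (hu : Real.exp (-(1 / 16)) ≤ u) : bandCutoff u = 0 := by
  have : Real.exp (-(1 / 4)) ≤ u ^ 4 := by
    calc Real.exp (-(1 / 4)) = Real.exp (-(1 / 16)) ^ 4 := by
          rw [← Real.exp_nat_mul]; norm_num
      _ ≤ u ^ 4 := by gcongr
  rw [bandCutoff, cutoff_eq_one this, sub_self, mul_zero]

/-- The transition zones do not overlap: whenever the cutoff at u⁴ is nonzero, u already lies where
the cutoff equals one. Passing from u to u⁴ corresponds to halving N. -/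
theorem bandCutoff_eq {u : ℝ} (hu : 0 < u) : bandCutoff u = cutoff u - cutoff (u ^ 4) := by
  rw [bandCutoff]
  rcases le_or_gt (u ^ 4) (Real.exp (-1)) with h | h
  · rw [cutoff_eq_zero h]; ring
  · have : Real.exp (-(1 / 4)) ≤ u := by
      have h2 : Real.exp (-(1 / 4)) ^ 4 < u ^ 4 := by
        rw [← Real.exp_nat_mul]; norm_num; exact h
      exact (lt_of_pow_lt_pow_left₀ 4 hu.le h2).le
    rw [cutoff_eq_one this]; ring

/-- The quotient by u frees the factor of the heat node demanded by `exists_multKernel_bound`; it is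
smooth because the cutoff vanishes near u ≤ 0. -/
theorem contDiff_cutoff_div : ContDiff ℝ ∞ fun z : ℝ × ℝ => cutoff z.2 / z.2 := by
  rw [contDiff_iff_contDiffAt]
  rintro ⟨η, u⟩
  rcases le_or_gt u 0 with hu | hu
  · have hev : (fun z : ℝ × ℝ => cutoff z.2 / z.2) =ᶠ[𝓝 (η, u)] fun _ => 0 := by
      have : ∀ᶠ z : ℝ × ℝ in 𝓝 (η, u), z.2 < Real.exp (-1) :=
        continuous_snd.continuousAt.eventually_lt continuousAt_const
          (show u < Real.exp (-1) from hu.trans_lt (Real.exp_pos _))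
      filter_upwards [this] with z hz
      rw [cutoff_eq_zero hz.le, zero_div]
    exact contDiffAt_const.congr_of_eventuallyEq hev
  · exact (contDiff_cutoff.comp contDiff_snd).contDiffAt.div contDiff_snd.contDiffAt hu.ne'

/-- At a heat node √(-log u) = λ/N, so with η² = 1/N the base is (λ + 1)/N. Band limitation removes
the singularities at u ≤ 0 and u ≥ 1. The parameter enters as η², keeping the base positive for
every real η when 0 < u < 1, so the family is jointly smooth even across η = 0. -/
theorem contDiff_bandCutoff_div (r : ℝ) : ContDiff ℝ ∞ fun z : ℝ × ℝ =>
    bandCutoff z.2 / z.2 * (Real.sqrt (-Real.log z.2) + z.1 ^ 2) ^ (-r) := by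
  rw [contDiff_iff_contDiffAt]
  rintro ⟨η, u⟩
  rcases le_or_gt u 0 with hu | hu
  · have hev : (fun z : ℝ × ℝ => bandCutoff z.2 / z.2 *
        (Real.sqrt (-Real.log z.2) + z.1 ^ 2) ^ (-r)) =ᶠ[𝓝 (η, u)] fun _ => 0 := by
      have : ∀ᶠ z : ℝ × ℝ in 𝓝 (η, u), z.2 < Real.exp (-1) :=
        continuous_snd.continuousAt.eventually_lt continuousAt_const
          (show u < Real.exp (-1) from hu.trans_lt (Real.exp_pos _))
      filter_upwards [this] with z hz
      rw [bandCutoff_eq_zero hz.le, zero_div, zero_mul]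
    exact contDiffAt_const.congr_of_eventuallyEq hev
  rcases le_or_gt 1 u with hu1 | hu1
  · have hev : (fun z : ℝ × ℝ => bandCutoff z.2 / z.2 *
        (Real.sqrt (-Real.log z.2) + z.1 ^ 2) ^ (-r)) =ᶠ[𝓝 (η, u)] fun _ => 0 := by
      have h1 : Real.exp (-(1 / 16)) < 1 := by rw [Real.exp_lt_one_iff]; norm_num
      have : ∀ᶠ z : ℝ × ℝ in 𝓝 (η, u), Real.exp (-(1 / 16)) < z.2 :=
        continuousAt_const.eventually_lt continuous_snd.continuousAt
          (show Real.exp (-(1 / 16)) < u from h1.trans_le hu1)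
      filter_upwards [this] with z hz
      rw [bandCutoff_eq_zero' hz.le, zero_div, zero_mul]
    exact contDiffAt_const.congr_of_eventuallyEq hev
  · have hlog : 0 < -Real.log u := by linarith [Real.log_neg hu hu1]
    have hs : 0 < Real.sqrt (-Real.log u) := Real.sqrt_pos.2 hlog
    have hb : ContDiff ℝ ∞ bandCutoff :=
      contDiff_cutoff.mul (contDiff_const.sub (contDiff_cutoff.comp (contDiff_id.pow 4)))
    have hbase : ContDiffAt ℝ ∞ (fun z : ℝ × ℝ => Real.sqrt (-Real.log z.2) + z.1 ^ 2) (η, u) :=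
      ((contDiff_snd.contDiffAt.log hu.ne').neg.sqrt hlog.ne').add (contDiff_fst.pow 2).contDiffAt
    exact ((hb.comp contDiff_snd).contDiffAt.div contDiff_snd.contDiffAt hu.ne').mul
      (hbase.rpow_const_of_ne (show Real.sqrt (-Real.log u) + η ^ 2 ≠ 0 by positivity))

end Cutoff

/-! ### Spectral support of the cutoffs. -/

section Nodes

variable {lam : ℕ → ℝ}

theorem heatNode_le_exp_neg_one {N : ℝ} (hN : 0 < N) {k : ℕ} (hk : N ≤ lam k) :
    heatNode lam N k ≤ Real.exp (-1) := by
  rw [heatNode, Real.exp_le_exp]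
  have : 1 ≤ lam k / N := by rwa [le_div_iff₀ hN, one_mul]
  nlinarith

theorem exp_le_heatNode {N : ℝ} (hN : 0 < N) {k : ℕ} (h0 : 0 ≤ lam k) (hk : lam k ≤ N / 2) :
    Real.exp (-(1 / 4)) ≤ heatNode lam N k := by
  rw [heatNode, Real.exp_le_exp]
  have h1 : lam k / N ≤ 1 / 2 := by rw [div_le_iff₀ hN]; linarith
  have h2 : 0 ≤ lam k / N := by positivity
  nlinarith

theorem heatNode_two_mul_pow (lam : ℕ → ℝ) (N : ℝ) (k : ℕ) :
    heatNode lam (2 * N) k ^ 4 = heatNode lam N k := by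
  rw [heatNode, heatNode, ← Real.exp_nat_mul]
  congr 1
  push_cast
  rw [mul_comm 2 N, ← div_div]
  ring

/-- The indices of the eigenvalues below `N`. -/
def lowIdx (lam : ℕ → ℝ) (N : ℝ) : Finset ℕ :=
  open Classical in if h : {k | lam k < N}.Finite then h.toFinset else ∅

theorem mem_lowIdx (ht : Tendsto lam atTop atTop) {N : ℝ} {k : ℕ} :
    k ∈ lowIdx lam N ↔ lam k < N := by
  have hf : {k | lam k < N}.Finite := by
    have h1 := ht.eventually_ge_atTop N
    rw [← Nat.cofinite_eq_atTop] at h1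
    refine Set.Finite.subset h1 fun k hk => ?_
    simpa using hk
  rw [lowIdx, dif_pos hf]
  simp

end Nodes

/-! ### Integrals of the low-pass and band-pass kernels. -/

section KernelIntegral

variable {X : Type*} [TopologicalSpace X] [MeasurableSpace X] [OpensMeasurableSpace X]

set_option linter.unusedSectionVars false

/-- Localization combined with dyadic growth. The measure σ is left free so that the estimate serves
both μ and |ν|. -/
theorem exists_lintegral_multKernel_bound (ρ : X → X → ℝ) (μ : Measure X) (q κ₁ κ₂ : ℝ)
    {κ₃ κ₄ D : ℝ} (hκ₃ : 0 < κ₃) (hκ₄ : 0 < κ₄) (hD : ∀ x y, ρ x y ≤ D) {Γ : ℝ × ℝ → ℝ}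
    (hΓ : ContDiff ℝ (⊤ : ℕ∞) Γ) :
    ∃ C : ℝ, 0 ≤ C ∧ ∀ (lam : ℕ → ℝ) (φ : ℕ → X → ℝ),
      IsDataDefinedSpace ρ μ lam φ q κ₁ κ₂ κ₃ κ₄ → ∀ (N : ℝ), 1 ≤ N →
      ∀ η ∈ Set.Icc (0 : ℝ) 1, ∀ s : Finset ℕ, (∀ k ∉ s, Γ (η, heatNode lam N k) = 0) →
      ∀ (σ : Measure X) (M : ℝ≥0∞),
        (∀ (x : X) (j : ℕ), σ (cball ρ x (2 ^ j / N)) ≤ M * ENNReal.ofReal (((2 : ℝ) ^ j) ^ q)) →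
      ∀ x : X, ∫⁻ y, ‖multKernel φ s (fun k => Γ (η, heatNode lam N k) * heatNode lam N k) x y‖ₑ ∂σ
        ≤ ENNReal.ofReal (C * N ^ q) * M := by
  obtain ⟨S, hS⟩ := exists_nat_ge (q + 1)
  obtain ⟨C, hC, hb⟩ := exists_multKernel_bound ρ μ q κ₁ κ₂ hκ₃ hκ₄ hD hΓ S
  refine ⟨2 ^ (S + 1) * C, by positivity, fun lam φ h N hN η hη s hs σ M hσ x => ?_⟩
  rw [mul_assoc]
  exact lintegral_le_of_localized h.measurableSet_cball hS σ M (by linarith) h.quasiMetric.nonneg x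
    _ (fun y => hb lam φ h N hN η hη s hs x y) (hσ x)

theorem IsDataDefinedSpace.measure_dyadic_ball_le {ρ : X → X → ℝ} {μ : Measure X} {lam : ℕ → ℝ}
    {φ : ℕ → X → ℝ} {q κ₁ κ₂ κ₃ κ₄ : ℝ} (h : IsDataDefinedSpace ρ μ lam φ q κ₁ κ₂ κ₃ κ₄)
    {N : ℝ} (hN : 0 < N) (x : X) (j : ℕ) : μ (cball ρ x (2 ^ j / N)) ≤
      ENNReal.ofReal (κ₂ * N ^ (-q)) * ENNReal.ofReal (((2 : ℝ) ^ j) ^ q) := by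
  have hκ₂ := h.κ₂_pos
  refine (h.measure_ball_le x _ (by positivity)).trans ?_
  rw [← ENNReal.ofReal_mul (by positivity)]
  apply ENNReal.ofReal_le_ofReal
  rw [Real.div_rpow (by positivity) hN.le, Real.rpow_neg hN.le]
  apply le_of_eq; ring

/-- The kernel of the low-pass operator. -/
def lowKernel (lam : ℕ → ℝ) (φ : ℕ → X → ℝ) (N : ℝ) : X → X → ℝ :=
  multKernel φ (lowIdx lam N) fun k => cutoff (heatNode lam N k)

theorem exists_lowKernel_bound (ρ : X → X → ℝ) (μ : Measure X) (q κ₁ κ₂ : ℝ)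
    {κ₃ κ₄ D : ℝ} (hκ₃ : 0 < κ₃) (hκ₄ : 0 < κ₄) (hD : ∀ x y, ρ x y ≤ D) :
    ∃ C : ℝ, 0 ≤ C ∧ ∀ (lam : ℕ → ℝ) (φ : ℕ → X → ℝ),
      IsDataDefinedSpace ρ μ lam φ q κ₁ κ₂ κ₃ κ₄ → ∀ (N : ℝ), 1 ≤ N →
      ∀ (σ : Measure X) (M : ℝ≥0∞),
        (∀ (x : X) (j : ℕ), σ (cball ρ x (2 ^ j / N)) ≤ M * ENNReal.ofReal (((2 : ℝ) ^ j) ^ q)) →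
      ∀ x : X, ∫⁻ y, ‖lowKernel lam φ N x y‖ₑ ∂σ ≤ ENNReal.ofReal (C * N ^ q) * M := by
  obtain ⟨C, hC, hb⟩ := exists_lintegral_multKernel_bound ρ μ q κ₁ κ₂ hκ₃ hκ₄ hD
    contDiff_cutoff_div
  refine ⟨C, hC, fun lam φ h N hN σ M hσ x => ?_⟩
  have hk : (fun k => cutoff (heatNode lam N k)) =
      fun k => cutoff (heatNode lam N k) / heatNode lam N k * heatNode lam N k := by
    funext k
    rw [div_mul_cancel₀ _ (heatNode_pos lam N k).ne']
  rw [lowKernel, hk]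
  refine hb lam φ h N hN 0 (by simp) (lowIdx lam N) (fun k hk => ?_) σ M hσ x
  rw [mem_lowIdx h.lam_tendsto, not_lt] at hk
  simp only
  rw [cutoff_eq_zero (heatNode_le_exp_neg_one (by linarith) hk), zero_div]

theorem mul_rpow_mul_rpow_neg {N : ℝ} (hN : 0 < N) (C κ q : ℝ) :
    C * N ^ q * (κ * N ^ (-q)) = C * κ := by
  have : N ^ q * N ^ (-q) = 1 := by rw [← Real.rpow_add hN]; simp
  linear_combination C * κ * this

/-- The band-pass kernel composed with the fractional integration of order `r`. -/
theorem exists_bandKernel_bound (ρ : X → X → ℝ) (μ : Measure X) (q κ₁ : ℝ)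
    {κ₂ κ₃ κ₄ D : ℝ} (hκ₂ : 0 < κ₂) (hκ₃ : 0 < κ₃) (hκ₄ : 0 < κ₄) (hD : ∀ x y, ρ x y ≤ D) (r : ℝ) :
    ∃ C : ℝ, 0 ≤ C ∧ ∀ (lam : ℕ → ℝ) (φ : ℕ → X → ℝ),
      IsDataDefinedSpace ρ μ lam φ q κ₁ κ₂ κ₃ κ₄ → ∀ (N : ℝ), 1 ≤ N →
      ∀ x : X, ∫⁻ y, ‖multKernel φ (lowIdx lam N)
        (fun k => bandCutoff (heatNode lam N k) * (lam k + 1) ^ (-r)) x y‖ₑ ∂μ ≤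
          ENNReal.ofReal (C * N ^ (-r)) := by
  obtain ⟨C, hC, hb⟩ := exists_lintegral_multKernel_bound ρ μ q κ₁ κ₂ hκ₃ hκ₄ hD
    (contDiff_bandCutoff_div r)
  refine ⟨C * κ₂, by positivity, fun lam φ h N hN x => ?_⟩
  have hN0 : 0 < N := by linarith
  -- The shift by 1 in λ + 1 becomes 1/N after rescaling; treating it as the compact parameter η²
  -- gives constants uniform in N.
  set η := Real.sqrt (1 / N) with hηdef
  have hη2 : η ^ 2 = 1 / N := Real.sq_sqrt (by positivity)
  have hη : η ∈ Set.Icc (0 : ℝ) 1 := by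
    refine ⟨Real.sqrt_nonneg _, ?_⟩
    rw [hηdef, Real.sqrt_le_iff, one_pow, div_le_one hN0]
    exact ⟨zero_le_one, hN⟩
  have hlam : ∀ k, 0 ≤ lam k := fun k => h.lam_zero ▸ h.lam_mono (Nat.zero_le k)
  set m : ℕ → ℝ := fun k => bandCutoff (heatNode lam N k) / heatNode lam N k *
    (Real.sqrt (-Real.log (heatNode lam N k)) + η ^ 2) ^ (-r) * heatNode lam N k with hm
  have hk : ∀ k, bandCutoff (heatNode lam N k) * (lam k + 1) ^ (-r) = N ^ (-r) * m k := by
    intro k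
    have h1 : Real.sqrt (-Real.log (heatNode lam N k)) = lam k / N := by
      rw [heatNode, Real.log_exp, neg_neg, Real.sqrt_sq (div_nonneg (hlam k) hN0.le)]
    have h2 : lam k + 1 = N * (lam k / N + 1 / N) := by field_simp
    have h3 : 0 ≤ lam k / N + 1 / N := by have := hlam k; positivity
    simp only [hm]
    rw [h1, hη2, h2, Real.mul_rpow hN0.le h3, mul_right_comm,
      div_mul_cancel₀ _ (heatNode_pos lam N k).ne']
    ring
  have hker : ∀ y, multKernel φ (lowIdx lam N)
      (fun k => bandCutoff (heatNode lam N k) * (lam k + 1) ^ (-r)) x y =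
      N ^ (-r) * multKernel φ (lowIdx lam N) m x y := by
    intro y
    simp only [multKernel, hk, Finset.mul_sum, mul_assoc]
  have hNr : 0 ≤ N ^ (-r) := by positivity
  simp_rw [hker, enorm_mul]
  rw [lintegral_const_mul' _ _ enorm_ne_top, Real.enorm_of_nonneg hNr]
  have := hb lam φ h N hN η hη (lowIdx lam N) (fun k hk => by
    rw [mem_lowIdx h.lam_tendsto, not_lt] at hk
    simp only
    rw [bandCutoff_eq_zero (heatNode_le_exp_neg_one hN0 hk), zero_div, zero_mul]) μ _
      (h.measure_dyadic_ball_le hN0) x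
  rw [← ENNReal.ofReal_mul (by positivity), mul_rpow_mul_rpow_neg hN0] at this
  calc _ ≤ ENNReal.ofReal (N ^ (-r)) * ENNReal.ofReal (C * κ₂) := by gcongr
    _ = _ := by rw [← ENNReal.ofReal_mul hNr, mul_comm]

end KernelIntegral

/-! ### Low-pass operators and the K-functional. -/

section LowPass

set_option linter.unusedSectionVars false

variable {X : Type*} [TopologicalSpace X] [MeasurableSpace X] [OpensMeasurableSpace X]
  {𝕜 : Type*} [RCLike 𝕜] {ρ : X → X → ℝ} {μ : Measure X}
  [IsProbabilityMeasure μ] {lam : ℕ → ℝ} {φ : ℕ → X → ℝ} {q κ₁ κ₂ κ₃ κ₄ : ℝ}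

/-- The smooth projection onto the diffusion polynomials of degree less than `N`. -/
def lowPass (μ : Measure X) (lam : ℕ → ℝ) (φ : ℕ → X → ℝ) (N : ℝ) (f : X → 𝕜) : X → 𝕜 :=
  multOp μ φ (lowIdx lam N) (fun k => cutoff (heatNode lam N k)) f

theorem IsDataDefinedSpace.lam_nonneg (h : IsDataDefinedSpace ρ μ lam φ q κ₁ κ₂ κ₃ κ₄) (k : ℕ) :
    0 ≤ lam k := h.lam_zero ▸ h.lam_mono (Nat.zero_le k)

theorem IsDataDefinedSpace.continuous_lowPass (h : IsDataDefinedSpace ρ μ lam φ q κ₁ κ₂ κ₃ κ₄)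
    (N : ℝ) (f : X → 𝕜) : Continuous (lowPass μ lam φ N f) := h.continuous_multOp f _ _

theorem IsDataDefinedSpace.lowPass_sub (h : IsDataDefinedSpace ρ μ lam φ q κ₁ κ₂ κ₃ κ₄)
    {f g : X → 𝕜} (hf : Integrable f μ) (hg : Integrable g μ) (N : ℝ) :
    lowPass μ lam φ N (f - g) = lowPass μ lam φ N f - lowPass μ lam φ N g :=
  h.multOp_sub hf hg _ _

theorem IsDataDefinedSpace.coeff_lowPass (h : IsDataDefinedSpace ρ μ lam φ q κ₁ κ₂ κ₃ κ₄)
    {N : ℝ} (hN : 0 < N) (f : X → 𝕜) (k : ℕ) :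
    coeff μ φ (lowPass μ lam φ N f) k = ((cutoff (heatNode lam N k) : ℝ) : 𝕜) * coeff μ φ f k := by
  rw [lowPass, h.coeff_multOp]
  split_ifs with hk
  · rfl
  · rw [mem_lowIdx h.lam_tendsto, not_lt] at hk
    rw [cutoff_eq_zero (heatNode_le_exp_neg_one hN hk)]
    simp

theorem lowPass_mem_diffPolyDeg (ht : Tendsto lam atTop atTop) (N : ℝ) (f : X → 𝕜) :
    lowPass μ lam φ N f ∈ diffPolyDeg 𝕜 lam φ N := by
  have : lowPass μ lam φ N f = ∑ k ∈ lowIdx lam N,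
      (((cutoff (heatNode lam N k) : ℝ) : 𝕜) * coeff μ φ f k) • fun x => ((φ k x : ℝ) : 𝕜) := by
    funext x
    simp [lowPass, multOp, Finset.sum_apply]
  rw [this]
  exact Submodule.sum_mem _ fun k hk => Submodule.smul_mem _ _
    (Submodule.subset_span ⟨k, (mem_lowIdx ht).1 hk, rfl⟩)

theorem diffPolyDeg_le_diffPoly (lam : ℕ → ℝ) (φ : ℕ → X → ℝ) (N : ℝ) :
    diffPolyDeg 𝕜 lam φ N ≤ diffPoly 𝕜 φ :=
  Submodule.span_mono fun _ ⟨j, _, hj⟩ => ⟨j, hj⟩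

theorem IsDataDefinedSpace.memXp_lowPass (h : IsDataDefinedSpace ρ μ lam φ q κ₁ κ₂ κ₃ κ₄)
    (p : ℝ≥0∞) (N : ℝ) (f : X → 𝕜) : MemXp μ φ p (lowPass μ lam φ N f) :=
  ⟨h.memLp_of_continuous (h.continuous_lowPass N f) μ p, fun ε hε =>
    ⟨lowPass μ lam φ N f,
      diffPolyDeg_le_diffPoly lam φ N (lowPass_mem_diffPolyDeg h.lam_tendsto N f), by simpa using hε⟩⟩

/-- The mean is the coefficient at λ₀ = 0, where the cutoff equals one. -/
theorem IsDataDefinedSpace.integral_lowPass (h : IsDataDefinedSpace ρ μ lam φ q κ₁ κ₂ κ₃ κ₄)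
    {N : ℝ} (hN : 0 < N) (f : X → 𝕜) : ∫ x, lowPass μ lam φ N f x ∂μ = ∫ x, f x ∂μ := by
  have := h.coeff_lowPass hN f 0
  have h1 : cutoff (heatNode lam N 0) = 1 :=
    cutoff_eq_one (exp_le_heatNode hN (h.lam_nonneg 0) (by rw [h.lam_zero]; positivity))
  rw [h1] at this
  simpa [coeff, h.φ_zero] using this

/-- Pseudo-derivatives commute with the low-pass operator. -/
theorem IsDataDefinedSpace.isPseudoDeriv_lowPass
    (h : IsDataDefinedSpace ρ μ lam φ q κ₁ κ₂ κ₃ κ₄) {p : ℝ≥0∞} {r N : ℝ} (hN : 0 < N)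
    {f g : X → 𝕜} (hfg : IsPseudoDeriv μ lam φ p r f g) :
    IsPseudoDeriv μ lam φ p r (lowPass μ lam φ N f) (lowPass μ lam φ N g) := by
  refine ⟨h.memXp_lowPass p N f, h.memXp_lowPass p N g, fun k => ?_⟩
  rw [h.coeff_lowPass hN, h.coeff_lowPass hN, hfg.2.2 k]
  ring

theorem lowPass_eq_sum_of_le (ht : Tendsto lam atTop atTop) {N N' : ℝ} (hN : 0 < N) (hNN : N ≤ N')
    (f : X → 𝕜) (x : X) : lowPass μ lam φ N f x = ∑ k ∈ lowIdx lam N',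
      ((cutoff (heatNode lam N k) : ℝ) : 𝕜) * coeff μ φ f k * ((φ k x : ℝ) : 𝕜) := by
  refine Finset.sum_subset (fun k hk => ?_) fun k _ hk => ?_
  · rw [mem_lowIdx ht] at hk ⊢; linarith
  · rw [mem_lowIdx ht, not_lt] at hk
    simp only
    rw [cutoff_eq_zero (heatNode_le_exp_neg_one hN hk)]
    simp

/-- The coefficients of f are (λ + 1)^(-r) times those of its pseudo-derivative g. Estimating a band
of f through g is the source of the gain N^(-r). -/
theorem IsDataDefinedSpace.lowPass_two_mul_sub (h : IsDataDefinedSpace ρ μ lam φ q κ₁ κ₂ κ₃ κ₄)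
    {p : ℝ≥0∞} {r N : ℝ} (hN : 0 < N) {f g : X → 𝕜} (hfg : IsPseudoDeriv μ lam φ p r f g) :
    lowPass μ lam φ (2 * N) f - lowPass μ lam φ N f = multOp μ φ (lowIdx lam (2 * N))
      (fun k => bandCutoff (heatNode lam (2 * N) k) * (lam k + 1) ^ (-r)) g := by
  funext x
  rw [Pi.sub_apply, lowPass_eq_sum_of_le h.lam_tendsto hN (by linarith : N ≤ 2 * N), lowPass,
    multOp, multOp, ← Finset.sum_sub_distrib]
  refine Finset.sum_congr rfl fun k _ => ?_
  have h1 : (lam k + 1) ^ (-r) * (lam k + 1) ^ r = 1 := by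
    have : 0 < lam k + 1 := by linarith [h.lam_nonneg k]
    rw [← Real.rpow_add this]; simp
  have h2 : (((lam k + 1) ^ (-r) : ℝ) : 𝕜) * (((lam k + 1) ^ r : ℝ) : 𝕜) = 1 := by
    rw [← RCLike.ofReal_mul, h1, RCLike.ofReal_one]
  rw [hfg.2.2 k, bandCutoff_eq (heatNode_pos _ _ _), heatNode_two_mul_pow]
  push_cast
  linear_combination -(((cutoff (heatNode lam (2 * N) k) : ℝ) : 𝕜) -
    ((cutoff (heatNode lam N k) : ℝ) : 𝕜)) * coeff μ φ f k * ((φ k x : ℝ) : 𝕜) * h2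

/-- Reproduction of differences of low-pass operators. -/
theorem IsDataDefinedSpace.lowPass_reproduce (h : IsDataDefinedSpace ρ μ lam φ q κ₁ κ₂ κ₃ κ₄)
    {N : ℝ} (hN : 0 < N) (f : X → 𝕜) :
    lowPass μ lam φ (4 * N) (lowPass μ lam φ (2 * N) f - lowPass μ lam φ N f) =
      lowPass μ lam φ (2 * N) f - lowPass μ lam φ N f := by
  have hi : ∀ M, Integrable (lowPass μ lam φ M f) μ := fun M =>
    h.integrable_of_continuous (h.continuous_lowPass M f) μ
  funext x
  have hc : ∀ k, coeff μ φ (lowPass μ lam φ (2 * N) f - lowPass μ lam φ N f) k =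
      (((cutoff (heatNode lam (2 * N) k) : ℝ) : 𝕜) - ((cutoff (heatNode lam N k) : ℝ) : 𝕜)) *
        coeff μ φ f k := by
    intro k
    rw [h.coeff_sub (hi _) (hi _), h.coeff_lowPass (by linarith), h.coeff_lowPass hN]
    ring
  rw [Pi.sub_apply, lowPass_eq_sum_of_le h.lam_tendsto hN (by linarith : N ≤ 4 * N),
    lowPass_eq_sum_of_le h.lam_tendsto (by linarith) (by linarith : 2 * N ≤ 4 * N),
    lowPass, multOp, ← Finset.sum_sub_distrib]
  refine Finset.sum_congr rfl fun k _ => ?_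
  rw [hc]
  -- Below 2N the cutoff at scale 4N equals one; from 2N on both cutoffs in the difference vanish.
  rcases lt_or_ge (lam k) (2 * N) with hk | hk
  · rw [cutoff_eq_one (exp_le_heatNode (by linarith : 0 < 4 * N) (h.lam_nonneg k) (by linarith))]
    push_cast
    ring
  · rw [cutoff_eq_zero (heatNode_le_exp_neg_one (by linarith : 0 < 2 * N) hk),
      cutoff_eq_zero (heatNode_le_exp_neg_one hN (by linarith))]
    simp

/-- Every diffusion polynomial is eventually reproduced. -/
theorem IsDataDefinedSpace.eventually_lowPass_eq (h : IsDataDefinedSpace ρ μ lam φ q κ₁ κ₂ κ₃ κ₄)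
    {P : X → 𝕜} (hP : P ∈ diffPoly 𝕜 φ) :
    Continuous P ∧ ∀ᶠ N : ℝ in atTop, lowPass μ lam φ N P = P := by
  induction hP using Submodule.span_induction with
  | mem P hP =>
    obtain ⟨j, rfl⟩ := hP
    refine ⟨RCLike.continuous_ofReal.comp (h.φ_continuous j), ?_⟩
    filter_upwards [eventually_gt_atTop 0, eventually_ge_atTop (2 * lam j),
      eventually_gt_atTop (lam j)] with N hN hN2 hN3
    funext x
    rw [lowPass, multOp, Finset.sum_eq_single j]
    · rw [h.coeff_eigen, if_pos rfl,
        cutoff_eq_one (exp_le_heatNode hN (h.lam_nonneg j) (by linarith))]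
      simp
    · intro k _ hk
      rw [h.coeff_eigen, if_neg hk.symm]
      simp
    · intro hj
      exact absurd ((mem_lowIdx h.lam_tendsto).2 hN3) hj
  | zero =>
    refine ⟨continuous_zero, Eventually.of_forall fun N => ?_⟩
    funext x
    simp [lowPass, multOp, coeff]
  | add P Q _ _ hP hQ =>
    refine ⟨hP.1.add hQ.1, ?_⟩
    filter_upwards [hP.2, hQ.2] with N h1 h2
    conv_rhs => rw [← h1, ← h2]
    funext x
    simp only [lowPass, multOp, Pi.add_apply, ← Finset.sum_add_distrib,
      h.coeff_add (h.integrable_of_continuous hP.1 μ) (h.integrable_of_continuous hQ.1 μ)]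
    exact Finset.sum_congr rfl fun k _ => by ring
  | smul c P _ hP =>
    refine ⟨hP.1.const_smul c, ?_⟩
    filter_upwards [hP.2] with N h1
    conv_rhs => rw [← h1]
    funext x
    simp only [lowPass, multOp, Pi.smul_apply, smul_eq_mul, Finset.mul_sum, coeff_smul]
    exact Finset.sum_congr rfl fun k _ => by ring

/-- Convergence of the low-pass operators, given their uniform boundedness. -/
theorem IsDataDefinedSpace.tendsto_lowPass (h : IsDataDefinedSpace ρ μ lam φ q κ₁ κ₂ κ₃ κ₄)
    {p : ℝ≥0∞} (hp : 1 ≤ p) {C : ℝ≥0∞} (hC : C ≠ ⊤)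
    (hb : ∀ N : ℝ, 1 ≤ N → ∀ f : X → 𝕜, MemLp f p μ →
      eLpNorm (lowPass μ lam φ N f) p μ ≤ C * eLpNorm f p μ)
    {f : X → 𝕜} (hf : MemXp μ φ p f) :
    Tendsto (fun N : ℝ => eLpNorm (lowPass μ lam φ N f - f) p μ) atTop (𝓝 0) := by
  rw [ENNReal.tendsto_nhds_zero]
  intro ε hε
  have hC1 : C + 1 ≠ ⊤ := by finiteness
  obtain ⟨P, hP, hPε⟩ := hf.2 (ε / (C + 1)) (ENNReal.div_pos hε.ne' hC1)
  obtain ⟨hPc, hPe⟩ := h.eventually_lowPass_eq hP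
  have hPm : MemLp P p μ := h.memLp_of_continuous hPc μ p
  filter_upwards [hPe, eventually_ge_atTop 1] with N hN hN1
  have hd : MemLp (f - P) p μ := hf.1.sub hPm
  have e : lowPass μ lam φ N f - f = lowPass μ lam φ N (f - P) - (f - P) := by
    rw [h.lowPass_sub (hf.1.integrable hp) (hPm.integrable hp), hN]
    abel
  rw [e]
  calc _ ≤ eLpNorm (lowPass μ lam φ N (f - P)) p μ + eLpNorm (f - P) p μ :=
        eLpNorm_sub_le (h.continuous_lowPass N _).aestronglyMeasurable hd.1 hp
    _ ≤ C * eLpNorm (f - P) p μ + eLpNorm (f - P) p μ := by gcongr; exact hb N hN1 _ hd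
    _ = (C + 1) * eLpNorm (f - P) p μ := by ring
    _ ≤ (C + 1) * (ε / (C + 1)) := by gcongr
    _ ≤ ε := ENNReal.mul_div_le

theorem le_mul_kFunctional {p : ℝ≥0∞} {r δ : ℝ} {f : X → 𝕜} {a C : ℝ≥0∞} (hC0 : C ≠ 0)
    (hC : C ≠ ⊤)
    (ha : ∀ f₁ g, IsPseudoDeriv μ lam φ p r f₁ g →
      a ≤ C * (eLpNorm (f - f₁) p μ + ENNReal.ofReal (δ ^ r) * eLpNorm g p μ)) :
    a ≤ C * kFunctional μ lam φ p r f δ := by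
  rw [mul_comm, ← ENNReal.div_le_iff_le_mul (Or.inl hC0) (Or.inl hC)]
  refine le_iInf fun f₁ => le_iInf fun g => le_iInf fun hg => ?_
  exact ENNReal.div_le_of_le_mul' (ha f₁ g hg)

/-- Truncating a competitor and its pseudo-derivative gives a competitor for the truncated function,
at the cost of the operator norm. -/
theorem kFunctional_lowPass_le (h : IsDataDefinedSpace ρ μ lam φ q κ₁ κ₂ κ₃ κ₄)
    {p : ℝ≥0∞} (hp : 1 ≤ p) {C : ℝ≥0∞} (hC0 : C ≠ 0) (hC : C ≠ ⊤) {N : ℝ} (hN : 0 < N)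
    (hb : ∀ f : X → 𝕜, MemLp f p μ → eLpNorm (lowPass μ lam φ N f) p μ ≤ C * eLpNorm f p μ)
    {r : ℝ} {f : X → 𝕜} (hf : MemLp f p μ) (δ : ℝ) :
    kFunctional μ lam φ p r (lowPass μ lam φ N f) δ ≤ C * kFunctional μ lam φ p r f δ := by
  refine le_mul_kFunctional hC0 hC fun f₁ g hg => ?_
  have h1 := h.isPseudoDeriv_lowPass hN hg
  have h2 : kFunctional μ lam φ p r (lowPass μ lam φ N f) δ ≤
      eLpNorm (lowPass μ lam φ N f - lowPass μ lam φ N f₁) p μ +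
        ENNReal.ofReal (δ ^ r) * eLpNorm (lowPass μ lam φ N g) p μ :=
    iInf_le_of_le _ (iInf_le_of_le _ (iInf_le _ h1))
  refine h2.trans ?_
  rw [← h.lowPass_sub (hf.integrable hp) (hg.1.1.integrable hp)]
  calc _ ≤ C * eLpNorm (f - f₁) p μ + ENNReal.ofReal (δ ^ r) * (C * eLpNorm g p μ) := by
        gcongr
        · exact hb _ (hf.sub hg.1.1)
        · exact hb _ hg.2.1.1
    _ = _ := by ring

theorem hNorm_lowPass_le (h : IsDataDefinedSpace ρ μ lam φ q κ₁ κ₂ κ₃ κ₄)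
    {p : ℝ≥0∞} (hp : 1 ≤ p) {C : ℝ≥0∞} (hC0 : C ≠ 0) (hC : C ≠ ⊤) {N : ℝ} (hN : 0 < N)
    (hb : ∀ f : X → 𝕜, MemLp f p μ → eLpNorm (lowPass μ lam φ N f) p μ ≤ C * eLpNorm f p μ)
    {γ r : ℝ} {f : X → 𝕜} (hf : MemLp f p μ) :
    hNorm μ lam φ p γ r (lowPass μ lam φ N f) ≤ C * hNorm μ lam φ p γ r f := by
  unfold hNorm
  rw [mul_add]
  gcongr
  · exact hb f hf
  · refine iSup₂_le fun δ hδ => ?_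
    calc _ ≤ C * kFunctional μ lam φ p r f δ / ENNReal.ofReal (δ ^ γ) := by
          gcongr; exact kFunctional_lowPass_le h hp hC0 hC hN hb hf δ
      _ = C * (kFunctional μ lam φ p r f δ / ENNReal.ofReal (δ ^ γ)) := mul_div_assoc _ _ _
      _ ≤ _ := by
          gcongr
          exact le_iSup₂ (f := fun δ (_ : δ ∈ Set.Ioc (0 : ℝ) 1) =>
            kFunctional μ lam φ p r f δ / ENNReal.ofReal (δ ^ γ)) δ hδ

theorem kFunctional_le_hNorm {p : ℝ≥0∞} {γ r : ℝ} {f : X → 𝕜} {δ : ℝ} (hδ : 0 < δ) (hδ1 : δ ≤ 1) :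
    kFunctional μ lam φ p r f δ ≤ ENNReal.ofReal (δ ^ γ) * hNorm μ lam φ p γ r f := by
  have hpos : 0 < δ ^ γ := Real.rpow_pos_of_pos hδ γ
  have h1 : kFunctional μ lam φ p r f δ / ENNReal.ofReal (δ ^ γ) ≤ hNorm μ lam φ p γ r f := by
    refine le_trans ?_ le_add_self
    exact le_iSup₂ (f := fun δ (_ : δ ∈ Set.Ioc (0 : ℝ) 1) =>
      kFunctional μ lam φ p r f δ / ENNReal.ofReal (δ ^ γ)) δ ⟨hδ, hδ1⟩
  rwa [ENNReal.div_le_iff_le_mul (Or.inl (by simpa using hpos)) (Or.inl ENNReal.ofReal_ne_top),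
    mul_comm] at h1

end LowPass

/-! ### Estimates for dyadic differences. -/

section Steps

set_option linter.unusedSectionVars false

variable {X : Type*} [TopologicalSpace X] [MeasurableSpace X] [OpensMeasurableSpace X]
  (𝕜 : Type*) [RCLike 𝕜] (ρ : X → X → ℝ) (μ : Measure X) [IsProbabilityMeasure μ] (q κ₁ : ℝ)
  {κ₂ κ₃ κ₄ D : ℝ}

theorem inv_toReal_mem_Icc {p : ℝ≥0∞} (hp : 1 ≤ p) : (p⁻¹).toReal ∈ Set.Icc (0 : ℝ) 1 := by
  refine ⟨ENNReal.toReal_nonneg, ?_⟩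
  simpa using ENNReal.toReal_mono ENNReal.one_ne_top (ENNReal.inv_le_one.2 hp)

theorem exists_lowKernel_lintegral_le (hκ₂ : 0 < κ₂) (hκ₃ : 0 < κ₃) (hκ₄ : 0 < κ₄)
    (hD : ∀ x y, ρ x y ≤ D) :
    ∃ C : ℝ, 1 ≤ C ∧ ∀ (lam : ℕ → ℝ) (φ : ℕ → X → ℝ),
      IsDataDefinedSpace ρ μ lam φ q κ₁ κ₂ κ₃ κ₄ → ∀ (N : ℝ), 1 ≤ N → ∀ x,
        ∫⁻ y, ‖lowKernel lam φ N x y‖ₑ ∂μ ≤ ENNReal.ofReal C := by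
  obtain ⟨C, hC, hb⟩ := exists_lowKernel_bound ρ μ q κ₁ κ₂ hκ₃ hκ₄ hD
  refine ⟨C * κ₂ + 1, by nlinarith, fun lam φ h N hN x => ?_⟩
  have hN0 : 0 < N := by linarith
  refine (hb lam φ h N hN μ _ (h.measure_dyadic_ball_le hN0) x).trans ?_
  rw [← ENNReal.ofReal_mul (by positivity), mul_rpow_mul_rpow_neg hN0]
  exact ENNReal.ofReal_le_ofReal (by linarith)

theorem exists_lowPass_bound (hκ₂ : 0 < κ₂) (hκ₃ : 0 < κ₃) (hκ₄ : 0 < κ₄)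
    (hD : ∀ x y, ρ x y ≤ D) {p : ℝ≥0∞} (hp : 1 ≤ p) :
    ∃ C : ℝ, 1 ≤ C ∧ ∀ (lam : ℕ → ℝ) (φ : ℕ → X → ℝ),
      IsDataDefinedSpace ρ μ lam φ q κ₁ κ₂ κ₃ κ₄ → ∀ (N : ℝ), 1 ≤ N →
      ∀ f : X → 𝕜, MemLp f p μ →
        eLpNorm (lowPass μ lam φ N f) p μ ≤ ENNReal.ofReal C * eLpNorm f p μ := by
  obtain ⟨C, hC, hb⟩ := exists_lowKernel_lintegral_le ρ μ q κ₁ hκ₂ hκ₃ hκ₄ hD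
  exact ⟨C, hC, fun lam φ h N hN f hf =>
    h.eLpNorm_multOp_le hp hf _ _ (hb lam φ h N hN) ENNReal.ofReal_ne_top⟩

/-- For each competitor f₁, boundedness of the truncations handles f - f₁, and the band-pass kernel
applied to the pseudo-derivative of f₁ handles f₁ with gain (2N)^(-r); this explains the factor
2^(-r) in the constant. -/
theorem exists_step_bound (hκ₂ : 0 < κ₂) (hκ₃ : 0 < κ₃) (hκ₄ : 0 < κ₄)
    (hD : ∀ x y, ρ x y ≤ D) {p : ℝ≥0∞} (hp : 1 ≤ p) (r : ℝ) :
    ∃ C : ℝ, 1 ≤ C ∧ ∀ (lam : ℕ → ℝ) (φ : ℕ → X → ℝ),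
      IsDataDefinedSpace ρ μ lam φ q κ₁ κ₂ κ₃ κ₄ → ∀ (N : ℝ), 1 ≤ N →
      ∀ f : X → 𝕜, MemLp f p μ →
        eLpNorm (lowPass μ lam φ (2 * N) f - lowPass μ lam φ N f) p μ ≤
          ENNReal.ofReal C * kFunctional μ lam φ p r f (1 / N) := by
  obtain ⟨C₁, hC₁, h₁⟩ := exists_lowPass_bound 𝕜 ρ μ q κ₁ hκ₂ hκ₃ hκ₄ hD hp
  obtain ⟨C₂, hC₂, h₂⟩ := exists_bandKernel_bound ρ μ q κ₁ hκ₂ hκ₃ hκ₄ hD r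
  refine ⟨2 * C₁ + C₂ * 2 ^ (-r), ?_, fun lam φ h N hN f hf => ?_⟩
  · have : 0 ≤ C₂ * (2 : ℝ) ^ (-r) := by positivity
    linarith
  have hN0 : 0 < N := by linarith
  have hpos : 0 ≤ C₂ * (2 : ℝ) ^ (-r) := by positivity
  refine le_mul_kFunctional (by simp; positivity) ENNReal.ofReal_ne_top fun f₁ g hg => ?_
  have hf₁ := hg.1.1
  have hd : MemLp (f - f₁) p μ := hf.sub hf₁
  have hsub : ∀ M, lowPass μ lam φ M f =
      lowPass μ lam φ M (f - f₁) + lowPass μ lam φ M f₁ := fun M => by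
    rw [h.lowPass_sub (hf.integrable hp) (hf₁.integrable hp)]; abel
  have e : lowPass μ lam φ (2 * N) f - lowPass μ lam φ N f =
      (lowPass μ lam φ (2 * N) (f - f₁) - lowPass μ lam φ N (f - f₁)) +
        (lowPass μ lam φ (2 * N) f₁ - lowPass μ lam φ N f₁) := by
    rw [hsub (2 * N), hsub N]; abel
  have hcont : ∀ M (F : X → 𝕜), AEStronglyMeasurable (lowPass μ lam φ M F) μ := fun M F =>
    (h.continuous_lowPass M F).aestronglyMeasurable
  have b1 : eLpNorm (lowPass μ lam φ (2 * N) (f - f₁) - lowPass μ lam φ N (f - f₁)) p μ ≤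
      ENNReal.ofReal (2 * C₁) * eLpNorm (f - f₁) p μ := by
    refine (eLpNorm_sub_le (hcont _ _) (hcont _ _) hp).trans ?_
    refine (add_le_add (h₁ lam φ h (2 * N) (by linarith) _ hd)
      (h₁ lam φ h N hN _ hd)).trans (le_of_eq ?_)
    rw [ENNReal.ofReal_mul zero_le_two, ENNReal.ofReal_ofNat]
    ring
  have b2 : eLpNorm (lowPass μ lam φ (2 * N) f₁ - lowPass μ lam φ N f₁) p μ ≤
      ENNReal.ofReal (C₂ * 2 ^ (-r)) * (ENNReal.ofReal ((1 / N) ^ r) * eLpNorm g p μ) := by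
    rw [h.lowPass_two_mul_sub hN0 hg]
    refine (h.eLpNorm_multOp_le hp hg.2.1.1 _ _ (h₂ lam φ h (2 * N) (by linarith))
      ENNReal.ofReal_ne_top).trans (le_of_eq ?_)
    rw [← mul_assoc, ← ENNReal.ofReal_mul hpos]
    congr 2
    rw [Real.mul_rpow zero_le_two hN0.le, one_div, Real.inv_rpow hN0.le, Real.rpow_neg hN0.le]
    ring
  rw [e]
  refine (eLpNorm_add_le ((hcont _ _).sub (hcont _ _)) ((hcont _ _).sub (hcont _ _)) hp).trans ?_
  calc _ ≤ ENNReal.ofReal (2 * C₁) * eLpNorm (f - f₁) p μ +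
        ENNReal.ofReal (C₂ * 2 ^ (-r)) * (ENNReal.ofReal ((1 / N) ^ r) * eLpNorm g p μ) :=
        add_le_add b1 b2
    _ ≤ ENNReal.ofReal (2 * C₁ + C₂ * 2 ^ (-r)) * eLpNorm (f - f₁) p μ +
        ENNReal.ofReal (2 * C₁ + C₂ * 2 ^ (-r)) *
          (ENNReal.ofReal ((1 / N) ^ r) * eLpNorm g p μ) := by
        gcongr <;> linarith
    _ = _ := by rw [mul_add]

/-- The `L¹`-norms of dyadic differences with respect to a measure that is regular at scale
`1 / n`. -/
theorem exists_step_lintegral_bound (hκ₂ : 0 < κ₂) (hκ₃ : 0 < κ₃) (hκ₄ : 0 < κ₄)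
    (hD : ∀ x y, ρ x y ≤ D) {C₀ : ℝ} (hC₀ : 0 ≤ C₀)
    (hcov : ∀ (m : Measure X) (M : ℝ≥0∞) (d R : ℝ), 0 < d → d ≤ 1 → d ≤ R →
      (∀ x, m (cball ρ x d) ≤ M) → ∀ x, m (cball ρ x R) ≤ ENNReal.ofReal (C₀ * (R / d) ^ q) * M)
    {p : ℝ≥0∞} (hp : 1 ≤ p) (γ r : ℝ) :
    ∃ C : ℝ, 0 ≤ C ∧ ∀ (lam : ℕ → ℝ) (φ : ℕ → X → ℝ),
      IsDataDefinedSpace ρ μ lam φ q κ₁ κ₂ κ₃ κ₄ → ∀ (n : ℝ), 1 ≤ n →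
      ∀ (σ : Measure X) [IsFiniteMeasure σ] (M : ℝ≥0∞), (∀ x, σ (cball ρ x (1 / n)) ≤ M) →
      ∀ f : X → 𝕜, MemLp f p μ → ∀ i : ℕ,
        ∫⁻ x, ‖(lowPass μ lam φ (2 ^ (i + 1) * n) f - lowPass μ lam φ (2 ^ i * n) f) x‖ₑ ∂σ ≤
          ENNReal.ofReal (C * n ^ (-γ) * ((2 : ℝ) ^ (q * (p⁻¹).toReal - γ)) ^ i) *
            ((ENNReal.ofReal (n ^ q) * M) ^ (p⁻¹).toReal *
              σ Set.univ ^ (1 - (p⁻¹).toReal) * hNorm μ lam φ p γ r f) := by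
  obtain ⟨C₁, hC₁, h₁⟩ := exists_lowKernel_lintegral_le ρ μ q κ₁ hκ₂ hκ₃ hκ₄ hD
  obtain ⟨C₂, hC₂, h₂⟩ := exists_lowKernel_bound ρ μ q κ₁ κ₂ hκ₃ hκ₄ hD
  obtain ⟨C₃, hC₃, h₃⟩ := exists_step_bound 𝕜 ρ μ q κ₁ hκ₂ hκ₃ hκ₄ hD hp r
  set α := (p⁻¹).toReal with hα
  obtain ⟨hα0, hα1⟩ : 0 ≤ α ∧ α ≤ 1 := inv_toReal_mem_Icc hp
  set K : ℝ := C₂ * 4 ^ q * C₀ with hK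
  have hK0 : 0 ≤ K := by positivity
  refine ⟨K ^ α * C₃ * C₁ ^ (1 - α), by positivity, fun lam φ h n hn σ _ M hM f hf i => ?_⟩
  have hn0 : 0 < n := by linarith
  have h2i : (1 : ℝ) ≤ 2 ^ i := one_le_pow₀ one_le_two
  set N : ℝ := 2 ^ i * n with hNdef
  have hN : 1 ≤ N := by nlinarith
  have hN0 : 0 < N := by linarith
  have hN2 : (2 : ℝ) ^ (i + 1) * n = 2 * N := by rw [hNdef]; ring
  rw [hN2]
  set s := lowPass μ lam φ (2 * N) f - lowPass μ lam φ N f with hs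
  have hsm : MemLp s p μ := h.memLp_of_continuous
    ((h.continuous_lowPass _ _).sub (h.continuous_lowPass _ _)) μ p
  -- Writing the difference as its own truncation at 4N lets an L^p(μ) bound be converted into an
  -- L¹(σ) bound through a localized kernel.
  have hrep : multOp μ φ (lowIdx lam (4 * N)) (fun k => cutoff (heatNode lam (4 * N) k)) s = s :=
    h.lowPass_reproduce hN0 f
  -- Since σ is controlled only from scale 1/n on, balls are enlarged from 2^j/(4N) to 2^j/n. The
  -- unmatched factor (4N)^q of the kernel leaves (N/n)^q = 2^(iq), which enters with power 1/p.
  have hσ : ∀ (x : X) (j : ℕ), σ (cball ρ x (2 ^ j / (4 * N))) ≤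
      (ENNReal.ofReal C₀ * M) * ENNReal.ofReal (((2 : ℝ) ^ j) ^ q) := by
    intro x j
    have h2j : (1 : ℝ) ≤ 2 ^ j := one_le_pow₀ one_le_two
    have hsub : cball ρ x (2 ^ j / (4 * N)) ⊆ cball ρ x (2 ^ j / n) := by
      intro y hy
      simp only [cball, Set.mem_ofPred_eq] at hy ⊢
      refine hy.trans ?_
      gcongr
      nlinarith
    refine (measure_mono hsub).trans ((hcov σ M (1 / n) (2 ^ j / n) (by positivity)
      (by rw [div_le_one hn0]; exact hn) (by gcongr) hM x).trans (le_of_eq ?_))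
    have : (2 : ℝ) ^ j / n / (1 / n) = 2 ^ j := by field_simp
    rw [this, ENNReal.ofReal_mul hC₀]
    ring
  have key := h.lintegral_multOp_le hp hsm (lowIdx lam (4 * N))
    (fun k => cutoff (heatNode lam (4 * N) k)) σ (h₁ lam φ h (4 * N) (by linarith))
    (h₂ lam φ h (4 * N) (by linarith) σ _ hσ)
  rw [hrep] at key
  have hstep : eLpNorm s p μ ≤
      ENNReal.ofReal C₃ * (ENNReal.ofReal ((1 / N) ^ γ) * hNorm μ lam φ p γ r f) :=
    (h₃ lam φ h N hN f hf).trans (by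
      gcongr
      exact kFunctional_le_hNorm (by positivity) (by rw [div_le_one hN0]; exact hN))
  have e1 : (ENNReal.ofReal (C₂ * (4 * N) ^ q) * (ENNReal.ofReal C₀ * M)) ^ α =
      ENNReal.ofReal (K ^ α * ((2 : ℝ) ^ (q * α)) ^ i) * (ENNReal.ofReal (n ^ q) * M) ^ α := by
    have : ENNReal.ofReal (C₂ * (4 * N) ^ q) * (ENNReal.ofReal C₀ * M) =
        ENNReal.ofReal (K * ((2 : ℝ) ^ i) ^ q) * (ENNReal.ofReal (n ^ q) * M) := by
      rw [← mul_assoc, ← mul_assoc (ENNReal.ofReal (K * _)), ← ENNReal.ofReal_mul (by positivity),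
        ← ENNReal.ofReal_mul (by positivity)]
      congr 2
      rw [hNdef, Real.mul_rpow (by norm_num) (by positivity),
        Real.mul_rpow (by positivity) hn0.le, hK]
      ring
    rw [this, ENNReal.mul_rpow_of_nonneg _ _ hα0, ENNReal.ofReal_rpow_of_nonneg (by positivity) hα0,
      Real.mul_rpow hK0 (by positivity)]
    congr 3
    rw [← Real.rpow_natCast, ← Real.rpow_natCast, ← Real.rpow_mul zero_le_two,
      ← Real.rpow_mul zero_le_two, ← Real.rpow_mul zero_le_two]
    congr 1; ring
  have e2 : (ENNReal.ofReal C₁ * σ Set.univ) ^ (1 - α) =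
      ENNReal.ofReal (C₁ ^ (1 - α)) * σ Set.univ ^ (1 - α) := by
    rw [ENNReal.mul_rpow_of_nonneg _ _ (by linarith),
      ENNReal.ofReal_rpow_of_nonneg (by linarith) (by linarith)]
  have e3 : (1 / N) ^ γ = n ^ (-γ) * ((2 : ℝ) ^ (-γ)) ^ i := by
    rw [one_div, Real.inv_rpow hN0.le, ← Real.rpow_neg hN0.le, hNdef,
      Real.mul_rpow (by positivity) hn0.le, mul_comm, ← Real.rpow_natCast, ← Real.rpow_natCast,
      ← Real.rpow_mul zero_le_two, ← Real.rpow_mul zero_le_two, mul_comm (i : ℝ)]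
  have e4 : ((2 : ℝ) ^ (q * α - γ)) ^ i = ((2 : ℝ) ^ (q * α)) ^ i * ((2 : ℝ) ^ (-γ)) ^ i := by
    rw [← mul_pow, ← Real.rpow_add two_pos, sub_eq_add_neg]
  rw [← hα, e1, e2] at key
  refine key.trans ?_
  calc _ ≤ ENNReal.ofReal (K ^ α * ((2 : ℝ) ^ (q * α)) ^ i) * (ENNReal.ofReal (n ^ q) * M) ^ α *
        (ENNReal.ofReal C₃ * (ENNReal.ofReal ((1 / N) ^ γ) * hNorm μ lam φ p γ r f)) *
        (ENNReal.ofReal (C₁ ^ (1 - α)) * σ Set.univ ^ (1 - α)) := by gcongr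
    _ = (ENNReal.ofReal (K ^ α * ((2 : ℝ) ^ (q * α)) ^ i) * ENNReal.ofReal C₃ *
          ENNReal.ofReal ((1 / N) ^ γ) * ENNReal.ofReal (C₁ ^ (1 - α))) *
        ((ENNReal.ofReal (n ^ q) * M) ^ α * σ Set.univ ^ (1 - α) * hNorm μ lam φ p γ r f) := by
        ring
    _ = _ := by
        rw [← ENNReal.ofReal_mul (by positivity), ← ENNReal.ofReal_mul (by positivity),
          ← ENNReal.ofReal_mul (by positivity), e3, e4]
        congr 2
        ring

end Steps

/-! ### Integration against signed measures and the quadrature error. -/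

section Quadrature

set_option linter.unusedSectionVars false

variable {X : Type*} [MeasurableSpace X] {𝕜 : Type*} [RCLike 𝕜]

instance isFiniteMeasure_variation (ν : SignedMeasure X) : IsFiniteMeasure ν.variation := by
  rw [← SignedMeasure.totalVariation_eq_variation ν]
  infer_instance

theorem norm_sintegral_sub_le (ν : SignedMeasure X) {f g : X → 𝕜}
    (hf : Integrable f ν.variation) (hg : Integrable g ν.variation) :
    ‖sintegral ν f - sintegral ν g‖ₑ ≤ ∫⁻ x, ‖f x - g x‖ₑ ∂ν.variation := by
  have e : sintegral ν f - sintegral ν g = sintegral ν fun x => f x - g x :=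
    (VectorMeasure.integral_fun_sub (B := (ContinuousLinearMap.lsmul ℝ ℝ).flip) hf hg).symm
  rw [e, sintegral]
  refine VectorMeasure.enorm_integral_le_lintegral_enorm_transpose.trans (le_of_eq ?_)
  rw [VectorMeasure.variation_transpose_lsmul_flip]

/-- The infimum is itself admissible, because each defining inequality is closed in the constant and
|ν| is finite. -/
theorem measure_cball_le_regNorm {ρ : X → X → ℝ} {q d : ℝ} (hd : 0 < d) {ν : SignedMeasure X}
    (hν : IsRegular ρ q ν d) (x : X) :
    ν.variation (cball ρ x d) ≤ ENNReal.ofReal (regNorm ρ q ν d * d ^ q) := by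
  have hdq : 0 < d ^ q := Real.rpow_pos_of_pos hd q
  rw [← ENNReal.ofReal_toReal (measure_ne_top ν.variation (cball ρ x d))]
  apply ENNReal.ofReal_le_ofReal
  rw [← div_le_iff₀ hdq]
  refine le_csInf hν fun C hC => ?_
  rw [div_le_iff₀ hdq]
  exact ENNReal.toReal_le_of_le_ofReal (mul_nonneg hC.1 hdq.le) (hC.2 x)

theorem regNorm_nonneg (ρ : X → X → ℝ) (q d : ℝ) (ν : SignedMeasure X) : 0 ≤ regNorm ρ q ν d :=
  Real.sInf_nonneg fun _ hC => hC.1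

variable [TopologicalSpace X] [OpensMeasurableSpace X] {ρ : X → X → ℝ} {μ : Measure X}
  [IsProbabilityMeasure μ] {lam : ℕ → ℝ} {φ : ℕ → X → ℝ} {q κ₁ κ₂ κ₃ κ₄ : ℝ}

theorem tsum_ofReal_geometric_mul {c θ : ℝ} (hc : 0 ≤ c) (h0 : 0 ≤ θ) (h1 : θ < 1) (B : ℝ≥0∞) :
    ∑' i : ℕ, ENNReal.ofReal (c * θ ^ i) * B = ENNReal.ofReal (c * (1 - θ)⁻¹) * B := by
  rw [ENNReal.tsum_mul_right, ← ENNReal.ofReal_tsum_of_nonneg (fun i => by positivity)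
    ((summable_geometric_of_lt_one h0 h1).mul_left c), tsum_mul_left,
    tsum_geometric_of_lt_one h0 h1]

/-- A function whose dyadic low-pass differences are uniformly summable has a continuous
representative, the pointwise limit of its low-pass approximations. -/
theorem IsDataDefinedSpace.exists_continuous_representative
    (h : IsDataDefinedSpace ρ μ lam φ q κ₁ κ₂ κ₃ κ₄) {p : ℝ≥0∞} (hp : 1 ≤ p) {f : X → 𝕜}
    (hfm : MemLp f p μ) {n : ℝ} (hn : 1 ≤ n)
    (hf : Tendsto (fun N : ℝ => eLpNorm (lowPass μ lam φ N f - f) p μ) atTop (𝓝 0))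
    {u : ℕ → ℝ} (hu : Summable u)
    (hstep : ∀ i x, ‖(lowPass μ lam φ (2 ^ (i + 1) * n) f - lowPass μ lam φ (2 ^ i * n) f) x‖ ≤ u i) :
    ∃ g : X → 𝕜, Continuous g ∧ g =ᵐ[μ] f ∧ ∀ x, g x - lowPass μ lam φ n f x =
      ∑' i : ℕ, (lowPass μ lam φ (2 ^ (i + 1) * n) f - lowPass μ lam φ (2 ^ i * n) f) x := by
  set F : ℕ → X → 𝕜 := fun i => lowPass μ lam φ (2 ^ i * n) f with hF
  have hFc : ∀ i, Continuous (F i) := fun i => h.continuous_lowPass _ _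
  set g : X → 𝕜 := fun x => F 0 x + ∑' i, (F (i + 1) - F i) x with hg
  have hgc : Continuous g :=
    (hFc 0).add (continuous_tsum (fun i => (hFc (i + 1)).sub (hFc i)) hu hstep)
  have hunif := tendstoUniformly_tsum_nat hu hstep
  refine ⟨g, hgc, ?_, fun x => ?_⟩
  · have hN : Tendsto (fun i : ℕ => (2 : ℝ) ^ i * n) atTop atTop :=
      (tendsto_pow_atTop_atTop_of_one_lt one_lt_two).atTop_mul_const (by linarith)
    have h1 := hf.comp hN
    have hzero : eLpNorm (g - f) p μ = 0 := by
      refine le_antisymm (ENNReal.le_of_forall_pos_le_add fun ε hε _ => ?_) zero_le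
      have hε2 : (0 : ℝ) < ε / 2 := by positivity
      have e1 := Metric.tendstoUniformly_iff.1 hunif (ε / 2) hε2
      have hε3 : (0 : ℝ≥0∞) < ENNReal.ofReal (ε / 2) := by simpa using hε2
      have e2 := h1.eventually (gt_mem_nhds hε3)
      obtain ⟨k, hk1, hk2⟩ := (e1.and e2).exists
      have b1 : eLpNorm (g - F k) p μ ≤ ENNReal.ofReal (ε / 2) := by
        refine (eLpNorm_le_of_ae_bound (C := ε / 2) (ae_of_all _ fun x => ?_)).trans (by simp)
        have := hk1 x
        rw [dist_eq_norm] at this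
        have e3 : (g - F k) x = ∑' i, (F (i + 1) - F i) x -
            ∑ i ∈ Finset.range k, (F (i + 1) - F i) x := by
          have : ∑ i ∈ Finset.range k, (F (i + 1) - F i) x = F k x - F 0 x := by
            simpa using Finset.sum_range_sub (fun i => F i x) k
          rw [this, Pi.sub_apply, hg]
          ring
        rw [e3]
        exact this.le
      have e4 : g - f = (g - F k) + (F k - f) := by abel
      rw [e4, zero_add]
      refine (eLpNorm_add_le (hgc.sub (hFc k)).aestronglyMeasurable
        ((hFc k).aestronglyMeasurable.sub hfm.1) hp).trans ?_
      refine (add_le_add b1 hk2.le).trans (le_of_eq ?_)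
      rw [← ENNReal.ofReal_add hε2.le hε2.le, add_halves, ENNReal.ofReal_coe_nnreal]
    rw [eLpNorm_eq_zero_iff (hgc.aestronglyMeasurable.sub hfm.1)
      (zero_lt_one.trans_le hp).ne'] at hzero
    filter_upwards [hzero] with x hx
    exact sub_eq_zero.1 hx
  · have : F 0 = lowPass μ lam φ n f := by simp [hF]
    rw [← this, hg]
    ring

/-- The system `hd` supplies only facts about X, ρ and μ: diameter, covering constant, compactness,
support. The resulting constant is therefore valid for every other system on the same space with the
same κ's. -/
theorem exists_quadrature_constant (hd : IsDataDefinedSpace ρ μ lam φ q κ₁ κ₂ κ₃ κ₄)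
    {p : ℝ≥0∞} (hp : 1 ≤ p) {γ : ℝ} (r : ℝ) (hγ : q * (p⁻¹).toReal < γ) :
    ∃ c : ℝ, 0 < c ∧
      ∀ (lam : ℕ → ℝ) (φ : ℕ → X → ℝ), IsDataDefinedSpace ρ μ lam φ q κ₁ κ₂ κ₃ κ₄ →
      ∀ (n : ℝ), 1 ≤ n → ∀ (ν : SignedMeasure X) (A : ℝ), 0 ≤ A →
        IsRegular ρ q ν (1 / n) → ApproxQuadrature 𝕜 μ lam φ p γ r n A ν →
      ∀ f : X → 𝕜, MemH μ lam φ p γ r f →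
        (∃! g : X → 𝕜, Continuous g ∧ g =ᵐ[μ] f) ∧
        ∀ g : X → 𝕜, Continuous g → g =ᵐ[μ] f →
          Integrable g ν.variation ∧
          ‖(∫ x, f x ∂μ) - sintegral ν g‖ ≤
            c * (A + regNorm ρ q ν (1 / n) ^ (p⁻¹).toReal *
                (ν.variation Set.univ).toReal ^ (1 - (p⁻¹).toReal)) *
              ((hNorm μ lam φ p γ r f).toReal / n ^ γ) := by
  obtain ⟨D, hD⟩ := hd.exists_bounded
  obtain ⟨C₀, hC₀, hcov⟩ := hd.exists_measure_ball_le
  have := hd.isOpenPosMeasure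
  have := hd.compactSpace
  obtain ⟨C₁, hC₁, h₁⟩ := exists_lowPass_bound 𝕜 ρ μ q κ₁ hd.κ₂_pos hd.κ₃_pos hd.κ₄_pos hD hp
  obtain ⟨C₂, hC₂, h₂⟩ := exists_step_lintegral_bound 𝕜 ρ μ q κ₁ hd.κ₂_pos hd.κ₃_pos hd.κ₄_pos hD
    hC₀ hcov hp γ r
  set α := (p⁻¹).toReal with hα
  obtain ⟨hα0, hα1⟩ : 0 ≤ α ∧ α ≤ 1 := inv_toReal_mem_Icc hp
  set θ : ℝ := (2 : ℝ) ^ (q * α - γ) with hθ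
  have hθ0 : 0 ≤ θ := by positivity
  -- This is where γ > q/p is needed: the dyadic losses 2^(iq/p) are dominated by the gains 2^(-iγ).
  have hθ1 : θ < 1 := Real.rpow_lt_one_of_one_lt_of_neg one_lt_two (by linarith)
  have hθ2 : 0 < (1 - θ)⁻¹ := inv_pos.2 (by linarith)
  refine ⟨C₁ + C₂ * (1 - θ)⁻¹, by positivity,
    fun lam φ h n hn ν A hA hreg hquad f hf => ?_⟩
  have hn0 : 0 < n := by linarith
  have hfm : MemLp f p μ := hf.1.1
  have hH : hNorm μ lam φ p γ r f ≠ ⊤ := hf.2.ne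
  set H := hNorm μ lam φ p γ r f with hHdef
  set P : X → 𝕜 := lowPass μ lam φ n f with hP
  have hlim := h.tendsto_lowPass hp ENNReal.ofReal_ne_top (h₁ lam φ h) hf.1
  set E : ℕ → X → 𝕜 := fun i =>
    lowPass μ lam φ (2 ^ (i + 1) * n) f - lowPass μ lam φ (2 ^ i * n) f with hE
  have hEc : ∀ i, Continuous (E i) := fun i =>
    (h.continuous_lowPass _ _).sub (h.continuous_lowPass _ _)
  have hptw : ∀ i x, ‖E i x‖ ≤ (C₂ * n ^ (-γ) * (ENNReal.ofReal (n ^ q) ^ α * H).toReal) * θ ^ i := by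
    intro i x
    have hfin : ENNReal.ofReal (n ^ q) ^ α * H ≠ ⊤ :=
      ENNReal.mul_ne_top (ENNReal.rpow_ne_top_of_nonneg hα0 ENNReal.ofReal_ne_top) hH
    -- Against a Dirac mass, with M = 1 and total mass 1, the L¹ bound is a pointwise bound uniform
    -- in x, at the harmless cost of n^(q/p).
    have := h₂ lam φ h n hn (Measure.dirac x) 1 (fun y => prob_le_one) f hfm i
    rw [lintegral_dirac' _ (hEc i).measurable.enorm, measure_univ, ENNReal.one_rpow, mul_one,
      mul_one] at this
    rw [← toReal_enorm]
    refine (ENNReal.toReal_mono (ENNReal.mul_ne_top ENNReal.ofReal_ne_top hfin) this).trans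
      (le_of_eq ?_)
    rw [ENNReal.toReal_mul, ENNReal.toReal_ofReal (by positivity)]
    ring
  obtain ⟨g₀, hg₀c, hg₀f, hg₀s⟩ := h.exists_continuous_representative hp hfm hn hlim
    ((summable_geometric_of_lt_one hθ0 hθ1).mul_left _) hptw
  have huniq : ∀ g : X → 𝕜, Continuous g → g =ᵐ[μ] f → g = g₀ := fun g hg hgf =>
    (hg.ae_eq_iff_eq μ hg₀c).1 (hgf.trans hg₀f.symm)
  refine ⟨⟨g₀, ⟨hg₀c, hg₀f⟩, fun g hg => huniq g hg.1 hg.2⟩, fun g hg hgf => ?_⟩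
  rw [huniq g hg hgf]
  have hg₀i : Integrable g₀ ν.variation := h.integrable_of_continuous hg₀c _
  have hPi : Integrable P ν.variation := h.integrable_of_continuous (h.continuous_lowPass _ _) _
  refine ⟨hg₀i, ?_⟩
  set R := regNorm ρ q ν (1 / n) with hR
  have hR0 : 0 ≤ R := regNorm_nonneg _ _ _ _
  have hnq : 0 < n ^ q := Real.rpow_pos_of_pos hn0 q
  have hdiff : ∫⁻ x, ‖P x - g₀ x‖ₑ ∂ν.variation ≤
      ENNReal.ofReal (C₂ * n ^ (-γ) * (1 - θ)⁻¹) *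
        (ENNReal.ofReal R ^ α * ν.variation Set.univ ^ (1 - α) * H) := by
    calc ∫⁻ x, ‖P x - g₀ x‖ₑ ∂ν.variation
        ≤ ∫⁻ x, ∑' i, ‖E i x‖ₑ ∂ν.variation := by
          refine lintegral_mono fun x => ?_
          rw [← enorm_neg, neg_sub, hg₀s x]
          exact enorm_tsum_le_tsum_enorm
      _ = ∑' i, ∫⁻ x, ‖E i x‖ₑ ∂ν.variation :=
          lintegral_tsum fun i => (hEc i).measurable.enorm.aemeasurable
      _ ≤ ∑' i : ℕ, ENNReal.ofReal (C₂ * n ^ (-γ) * θ ^ i) *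
            (ENNReal.ofReal R ^ α * ν.variation Set.univ ^ (1 - α) * H) := by
          refine ENNReal.tsum_le_tsum fun i => ?_
          refine (h₂ lam φ h n hn ν.variation _
            (measure_cball_le_regNorm (by positivity) hreg) f hfm i).trans (le_of_eq ?_)
          congr 4
          rw [← ENNReal.ofReal_mul hnq.le]
          congr 1
          rw [← hR, one_div, Real.inv_rpow hn0.le]
          field_simp
      _ = _ := tsum_ofReal_geometric_mul (by positivity) hθ0 hθ1 _
  have hV : ν.variation Set.univ ≠ ⊤ := measure_ne_top _ _
  have hfin : ENNReal.ofReal R ^ α * ν.variation Set.univ ^ (1 - α) * H ≠ ⊤ :=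
    ENNReal.mul_ne_top (ENNReal.mul_ne_top
      (ENNReal.rpow_ne_top_of_nonneg hα0 ENNReal.ofReal_ne_top)
      (ENNReal.rpow_ne_top_of_nonneg (by linarith) hV)) hH
  have hsecond : ‖sintegral ν P - sintegral ν g₀‖ ≤ C₂ * n ^ (-γ) * (1 - θ)⁻¹ *
      (R ^ α * (ν.variation Set.univ).toReal ^ (1 - α) * H.toReal) := by
    rw [← toReal_enorm]
    refine (ENNReal.toReal_mono (ENNReal.mul_ne_top ENNReal.ofReal_ne_top hfin)
      ((norm_sintegral_sub_le ν hPi hg₀i).trans hdiff)).trans (le_of_eq ?_)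
    rw [ENNReal.toReal_mul, ENNReal.toReal_ofReal (by positivity), ENNReal.toReal_mul,
      ENNReal.toReal_mul, ← ENNReal.toReal_rpow, ← ENNReal.toReal_rpow, ENNReal.toReal_ofReal hR0]
  have hfirst : ‖(∫ x, P x ∂μ) - sintegral ν P‖ ≤ A * (C₁ * H.toReal) / n ^ γ := by
    refine (hquad P (lowPass_mem_diffPolyDeg h.lam_tendsto n f)).trans ?_
    have hPH : (hNorm μ lam φ p γ r P).toReal ≤ C₁ * H.toReal := by
      have := hNorm_lowPass_le h hp (by simp; linarith) ENNReal.ofReal_ne_top hn0 (h₁ lam φ h n hn)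
        (γ := γ) (r := r) hfm
      have := ENNReal.toReal_mono (ENNReal.mul_ne_top ENNReal.ofReal_ne_top hH) this
      rwa [ENNReal.toReal_mul, ENNReal.toReal_ofReal (by linarith)] at this
    gcongr
  -- Since truncation preserves the mean, the whole error is the quadrature error of P plus the
  -- ν-integral of P - g₀.
  have hsplit : (∫ x, f x ∂μ) - sintegral ν g₀ =
      ((∫ x, P x ∂μ) - sintegral ν P) + (sintegral ν P - sintegral ν g₀) := by
    rw [hP, h.integral_lowPass hn0]; ring
  rw [hsplit]
  refine (norm_add_le _ _).trans ((add_le_add hfirst hsecond).trans ?_)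
  have hγn : n ^ (-γ) = (n ^ γ)⁻¹ := Real.rpow_neg hn0.le γ
  set V := (ν.variation Set.univ).toReal ^ (1 - α)
  have hV0 : 0 ≤ V := by positivity
  have hRα : 0 ≤ R ^ α := by positivity
  have hT : 0 ≤ H.toReal / n ^ γ := by positivity
  rw [hγn]
  calc A * (C₁ * H.toReal) / n ^ γ + C₂ * (n ^ γ)⁻¹ * (1 - θ)⁻¹ * (R ^ α * V * H.toReal)
      = (C₁ * A + C₂ * (1 - θ)⁻¹ * (R ^ α * V)) * (H.toReal / n ^ γ) := by ring
    _ ≤ (C₁ + C₂ * (1 - θ)⁻¹) * (A + R ^ α * V) * (H.toReal / n ^ γ) := by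
        gcongr ?_ * _
        have a1 : 0 ≤ C₁ * (R ^ α * V) := by positivity
        have a2 : 0 ≤ C₂ * (1 - θ)⁻¹ * A := by positivity
        linarith

end Quadrature

end DataSpace

end

theorem theorem1 {X : Type*} [TopologicalSpace X] [MeasurableSpace X] [OpensMeasurableSpace X]
    {𝕜 : Type*} [RCLike 𝕜] (ρ : X → X → ℝ) (μ : MeasureTheory.Measure X)
    [MeasureTheory.IsProbabilityMeasure μ] (q κ₁ κ₂ κ₃ κ₄ : ℝ)
    (p : ENNReal) (hp : 1 ≤ p) (γ r : ℝ) (hγ : q * (p⁻¹).toReal < γ) (hr : γ < r) :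
    ∃ c : ℝ, 0 < c ∧
      ∀ (lam : ℕ → ℝ) (φ : ℕ → X → ℝ),
        DataSpace.IsDataDefinedSpace ρ μ lam φ q κ₁ κ₂ κ₃ κ₄ →
      ∀ (n : ℝ), 1 ≤ n → ∀ (ν : MeasureTheory.SignedMeasure X) (A : ℝ), 0 ≤ A →
        DataSpace.IsRegular ρ q ν (1 / n) →
        DataSpace.ApproxQuadrature 𝕜 μ lam φ p γ r n A ν →
      ∀ f : X → 𝕜, DataSpace.MemH μ lam φ p γ r f →
        (∃! g : X → 𝕜, Continuous g ∧ g =ᵐ[μ] f) ∧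
        ∀ g : X → 𝕜, Continuous g → g =ᵐ[μ] f →
          MeasureTheory.Integrable g ν.variation ∧
          ‖(∫ x, f x ∂μ) - DataSpace.sintegral ν g‖ ≤
            c * (A + DataSpace.regNorm ρ q ν (1 / n) ^ (p⁻¹).toReal *
                (ν.variation Set.univ).toReal ^ (1 - (p⁻¹).toReal)) *
              ((DataSpace.hNorm μ lam φ p γ r f).toReal / n ^ γ) := by

  -- The constant must precede the system, but the geometry of X is only known through some system.
  -- If one exists it provides the geometry for all; otherwise nothing is to be proved.
  by_cases hex : ∃ (lam : ℕ → ℝ) (φ : ℕ → X → ℝ),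
      DataSpace.IsDataDefinedSpace ρ μ lam φ q κ₁ κ₂ κ₃ κ₄
  · obtain ⟨lam, φ, hd⟩ := hex
    exact DataSpace.exists_quadrature_constant hd hp r hγ
  · exact ⟨1, one_pos, fun lam φ h => absurd ⟨lam, φ, h⟩ hex⟩
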